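/- **Setting.** Let $X=\{X_t:t\in\mathbb Z\}$ be a real (weakly) stationary process with finite second moments, mean $\mu$ and autocovariances $\gamma(h)=\mathrm{Cov}(X_t,X_{t+h})$. Let $\mathcal M_n$ be the closed linear span in $L^2$ of $\{X_t-\mu: t\le n\}$; $X$ is *purely nondeterministic* if $X_{n+1}-\mu\notin\mathcal M_n$ for all $n$ and $\bigcap_n\mathcal M_n=\{0\}$. If $\sum_h|\gamma(h)|<\infty$, the spectral density of $X$ is $f(\lambda)=(2\pi)^{-1}\sum_{h\in\mathbb Z}\gamma(h)e^{-ih\lambda}$. Write $\bar X_n=n^{-1}\sum_{t=1}^nX_t$. For a nonnegative, even, bounded function $g$ on $[-\pi,\pi]$ with $\int_{-\pi}^{\pi}\log g(\lambda)\,d\lambda>-\infty$, put $a_k(g)=(2\pi)^{-1}\int_{-\pi}^{\pi}\log g(\lambda)\,e^{-ik\lambda}\,d\lambda$ for $k\ge 0$, $\sigma^2(g)=2\pi\exp(a_0(g))$, $c_0(g)=1$ and $$c_{k+1}(g)=\sum_{j=0}^k\Bigl(1-\frac{j}{k+1}\Bigr)a_{k+1-j}(g)\,c_j(g),\qquad k\ge0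 .$$ For distributions with distribution functions $F$, $G$ on $\mathbb R$, Mallows' distance is $d_2=\bigl\{\int_0^1(F^{-1}(u)-G^{-1}(u))^2du\bigr\}^{1/2}$, where $F^{-1}(u)=\inf\{x:u\le F(x)\}$; for random variables, $d_2$ is the distance of their distributions. **Theorem.** Let $X$ be a purely nondeterministic stationary process with mean $\mu$, $\sum_h|\gamma(h)|<\infty$ and spectral density $f$, and assume $\sqrt n(\bar X_n-\mu)\to\mathcal N(0,2\pi f(0))$ in distribution. For each $n\ge1$ let $\hat f_n$ be an estimator of $f$ based on $X_1,\dots,X_n$ whose realizations are almost surely nonnegative, even and bounded on $[-\pi,\pi]$, with $\int_{-\pi}^{\pi}\log\hat f_n(\lambda)\,d\lambda>-\infty$ almost surely and $$\sup_{\lambda\in[0,\pi]}|\hat f_n(\lambda)-f(\lambda)|\to0\quad\text{in probability.}$$ Put $\hat c_{k,n}=c_k(\hat f_n)$ and $\hat\sigma_n^2=\sigma^2(\hat f_n)$, and assume that there is a constant $C$, not depending on $n$, with $\sum_{k=0}^\infty|\hat c_{k,n}|<C$ almost surely for all $n\ge1$. Given $X_1,\dots,X_n$, let (under the conditional bootstrap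 probability $P^*$) $\{\varepsilon_t^*:t\in\mathbb Z\}$ be i.i.d. with $E^*\varepsilon_t^*=0$, $E^*(\varepsilon_t^*)^2=\hat\sigma_n^2$ and $E^*(\varepsilon_t^*)^4<K$, where $K<\infty$ is a constant not depending on $n$ or on the data, and let the spectral density-driven bootstrap series be $$X_t^*=\sum_{j=0}^\infty\hat c_{j,n}\,\varepsilon^*_{t-j}+\bar X_n,\quad t=1,\dots,n,\qquad \bar X_n^*=\frac1n\sum_{t=1}^nX_t^* .$$ Then, as $n\to\infty$, $$d_2\bigl(\sqrt n(\bar X_n^*-\bar X_n),\ \sqrt n(\bar X_n-\mu)\bigr)\to0\quad\text{in probability,}$$ where the distribution of the first argument is the conditional one under $P^*$. -/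

import Mathlib

open MeasureTheory ProbabilityTheory Filter Topology
open scoped ENNReal NNReal

noncomputable section

namespace SDDB

section Observed

variable {Ω : Type*} [MeasurableSpace Ω]

/-- (Weak) stationarity of a real process indexed by the integers: finite second moments, constant
mean, and covariances that depend on the lag only. -/
structure IsStationary (X : ℤ → Ω → ℝ) (P : Measure Ω) : Prop where
  memLp : ∀ t, MemLp (X t) 2 P
  mean_eq : ∀ t, ∫ ω, X t ω ∂P = ∫ ω, X 0 ω ∂P
  cov_eq : ∀ t h, cov[X t, X (t + h); P] = cov[X 0, X h; P]

/-- The autocovariance function `γ(h) = Cov(X_0, X_h)` of a stationary process. -/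
def autocov (X : ℤ → Ω → ℝ) (P : Measure Ω) (h : ℤ) : ℝ := cov[X 0, X h; P]

/-- The linear past `M_n`: the closed linear span in `L²(P)` of the centred variables
`X_t - E X_t`, `t ≤ n`. -/
def linearPast (X : ℤ → Ω → ℝ) (P : Measure Ω) (n : ℤ) : Submodule ℝ (Lp ℝ 2 P) :=
  (Submodule.span ℝ
    {Y : Lp ℝ 2 P | ∃ t ≤ n, Y =ᵐ[P] fun ω => X t ω - ∫ ω', X t ω' ∂P}).topologicalClosure

/-- A process is purely nondeterministic if `X_{n+1} - E X_{n+1}` is never in the linear past `M_n`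
(it is nondeterministic), and the remote past `⋂ M_n` is trivial. -/
def IsPurelyNondeterministic (X : ℤ → Ω → ℝ) (P : Measure Ω) : Prop :=
  (∀ n : ℤ, ∀ Y ∈ linearPast X P n, ¬ (Y =ᵐ[P] fun ω => X (n + 1) ω - ∫ ω', X (n + 1) ω' ∂P)) ∧
    ⨅ n : ℤ, linearPast X P n = ⊥

/-- The observed stretch `(X_1, …, X_n)`. -/
def sample (X : ℤ → Ω → ℝ) (n : ℕ) (ω : Ω) : Fin n → ℝ := fun i => X ((i : ℤ) + 1) ω

end Observed

/-- The arithmetic mean of `x_1, …, x_n`. -/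
def mean {n : ℕ} (x : Fin n → ℝ) : ℝ := (∑ i, x i) / n

/-- The spectral density `f(λ) = (2π)⁻¹ ∑_h γ(h) e^{-ihλ}` of an absolutely summable autocovariance
function (the sum is real because `γ` is real and even). -/
def spectralDensity (γ : ℤ → ℝ) (l : ℝ) : ℝ :=
  ((2 * Real.pi : ℂ)⁻¹ * ∑' h : ℤ, (γ h : ℂ) * Complex.exp (-(Complex.I * h * l))).re

/-- A candidate for a spectral density: a nonnegative even function on `[-π, π]`. -/
def IsSpectralCandidate (g : ℝ → ℝ) : Prop :=
  ∀ l ∈ Set.Icc (-Real.pi) Real.pi, 0 ≤ g l ∧ g (-l) = g l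

/-- `∫_{(-π, π]} log g > -∞`, for a nonnegative function `g` that is bounded on `[-π, π]`: `g` is
positive almost everywhere (so that `log g` takes the value `-∞` on a null set only), and `log g`
is integrable. -/
def LogIntegrable (g : ℝ → ℝ) : Prop :=
  (∀ᵐ l ∂(volume.restrict (Set.Ioc (-Real.pi) Real.pi)), 0 < g l) ∧
    IntegrableOn (fun l => Real.log (g l)) (Set.Ioc (-Real.pi) Real.pi)

/-- The Fourier coefficient `a_k = (2π)⁻¹ ∫_{-π}^{π} log g(λ) e^{-ikλ} dλ` of `log g` (a real number
because `g` is even). -/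
def logFourierCoeff (g : ℝ → ℝ) (k : ℕ) : ℝ :=
  ((2 * Real.pi : ℂ)⁻¹ *
    ∫ l in (-Real.pi)..Real.pi, (Real.log (g l) : ℂ) * Complex.exp (-(Complex.I * k * l))).re

/-- `c_0 = 1` and `c_{k+1} = ∑_{j=0}^{k} (1 - j/(k+1)) a_{k+1-j} c_j`. -/
def woldRec (a : ℕ → ℝ) : ℕ → ℝ
  | 0 => 1
  | k + 1 => ∑ j : Fin (k + 1), (1 - (j : ℝ) / (k + 1)) * a (k + 1 - j) * woldRec a j
termination_by n => n
decreasing_by exact j.isLt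

/-- The Wold coefficients `c_k` computed from the spectral density `g`. -/
def woldCoeff (g : ℝ → ℝ) : ℕ → ℝ := woldRec (logFourierCoeff g)

/-- The innovation variance `σ² = 2π exp(a_0)` computed from the spectral density `g`. -/
def innovVar (g : ℝ → ℝ) : ℝ := 2 * Real.pi * Real.exp (logFourierCoeff g 0)

section Bootstrap

variable {Ω' : Type*} [MeasurableSpace Ω']

/-- Under `Q`, the process `(ε_t)` is i.i.d. with mean `0`, variance `v`, and a fourth moment that
is finite and less than `K`. -/
structure IsInnovation (ε : ℤ → Ω' → ℝ) (Q : Measure Ω') (v K : ℝ) : Prop where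
  indep : iIndepFun ε Q
  ident : ∀ t, IdentDistrib (ε t) (ε 0) Q Q
  memLp : MemLp (ε 0) 4 Q
  mean_zero : ∫ ω, ε 0 ω ∂Q = 0
  variance_eq : ∫ ω, ε 0 ω ^ 2 ∂Q = v
  fourth_lt : ∫ ω, ε 0 ω ^ 4 ∂Q < K

/-- The pseudo series `X*_t = ∑_{j ≥ 0} c_j ε_{t-j} + m`, `t = 1, …, n`, where the `c_j` are the
Wold coefficients computed from the spectral density `g`. -/
def pseudoSeries (g : ℝ → ℝ) (m : ℝ) (ε : ℤ → Ω' → ℝ) (n : ℕ) (ω' : Ω') : Fin n → ℝ :=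
  fun i => (∑' j : ℕ, woldCoeff g j * ε ((i : ℤ) + 1 - j) ω') + m

end Bootstrap

/-- Convergence to `0` in probability of `[0, ∞]`-valued random quantities (in outer probability,
if a `Y n` is not measurable). -/
def TendstoZeroInProb {Ω : Type*} [MeasurableSpace Ω] (P : Measure Ω) (Y : ℕ → Ω → ℝ≥0∞) : Prop :=
  ∀ δ : ℝ≥0∞, 0 < δ → Tendsto (fun n => P {ω | δ ≤ Y n ω}) atTop (𝓝 0)

/-- The quantile function `F⁻¹(u) = inf {x | u ≤ F(x)}` of a probability measure on the line. -/
def quantile (ρ : Measure ℝ) (u : ℝ) : ℝ := sInf {x : ℝ | u ≤ cdf ρ x}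

/-- Mallows' distance `d₂ = (∫_0^1 (F⁻¹(u) - G⁻¹(u))² du)^{1/2}` of two distributions on the line,
as an extended nonnegative number. -/
def mallows (ρ τ : Measure ℝ) : ℝ≥0∞ :=
  (∫⁻ u in Set.Ioo (0 : ℝ) 1, ENNReal.ofReal ((quantile ρ u - quantile τ u) ^ 2)) ^ (1 / 2 : ℝ)

end SDDB

end

/-! On the line, weak convergence together with convergence of second moments implies convergence in
Mallows' distance (`tendsto_mallows_of_tendsto`). By the triangle inequality it is enough to bring
each of the two laws close to `N(0, 2πf(0))`.

For the observed process the weak limit is given, and the second moment is the normalized double sum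
of autocovariances, which converges to `∑ γ(h) = 2πf(0)` by Cesàro averaging.

The bootstrap statistic is a weighted sum `∑ w_k ε_k` of i.i.d. variables. Since `∑|c_j| ≤ C`, the
weights satisfy `|w_k| ≤ C/√n` and `∑ w_k² ≤ C²`, so a Taylor expansion of characteristic functions,
controlled by the fourth moment bound `K`, makes its law asymptotically Gaussian with matching
variance (`IsInnovation.norm_charFun_tsum_sub_le`).

The remaining point is that variance. The recursion says that `∑ c_k z^k` is the exponential of the
analytic part of `log g` without its constant term, so that `g = (σ²/2π)|∑ c_k e^{ikλ}|²` almost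
everywhere (`ae_eq_innovVar_mul_norm_sq`). By Parseval the bootstrap variance is then `n⁻¹ ∫ g
|D_n|²`, with `D_n` the Dirichlet-type sum, while the observed one is `n⁻¹ ∫ f |D_n|²`. As `∫ |D_n|²
= 2πn`, they differ by at most `2π sup|g - f|` (`abs_innovVar_mul_sub_le`). No continuity of the
estimator at `0` is needed.

All these bounds depend on the data only through `sup|g - f|`. A contradiction argument turns the
sequential limit theorem into a uniform one (`exists_forall_mallows_lt`), so the event of a large
distance lies, up to a null set, in the event of a large estimation error. -/

noncomputable section

namespace SDDB

/-! ### Quantile functions and the Mallows distance. -/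

section Quantile

variable (ρ τ κ : Measure ℝ)

/-- Right continuity of the distribution function makes the infimum attained; `0 < u < 1` keeps the
set bounded below and nonempty. This Galois connection is the source of the other facts on
quantiles. -/
theorem quantile_le_iff {u : ℝ} (hu : u ∈ Set.Ioo (0 : ℝ) 1) (x : ℝ) :
    quantile ρ u ≤ x ↔ u ≤ cdf ρ x := by
  have hbdd : BddBelow {x : ℝ | u ≤ cdf ρ x} := by
    obtain ⟨b, hb⟩ := ((tendsto_cdf_atBot ρ).eventually_lt_const hu.1).exists
    refine ⟨b, fun y hy => ?_⟩
    by_contra! h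
    exact absurd (hy.trans (monotone_cdf ρ h.le)) (not_le.2 hb)
  have hne : {x : ℝ | u ≤ cdf ρ x}.Nonempty := by
    obtain ⟨b, hb⟩ := ((tendsto_cdf_atTop ρ).eventually_const_lt hu.2).exists
    exact ⟨b, hb.le⟩
  constructor
  · intro h
    have hright : Tendsto (cdf ρ) (𝓝[>] x) (𝓝 (cdf ρ x)) :=
      ((cdf ρ).right_continuous x).tendsto.mono_left (nhdsWithin_mono _ Set.Ioi_subset_Ici_self)
    refine ge_of_tendsto hright ?_
    filter_upwards [self_mem_nhdsWithin] with y hy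
    obtain ⟨z, hz, hzy⟩ := exists_lt_of_csInf_lt hne (lt_of_le_of_lt h hy)
    exact le_trans hz (monotone_cdf ρ hzy.le)
  · exact fun h => csInf_le hbdd h

theorem lt_quantile_iff {u : ℝ} (hu : u ∈ Set.Ioo (0 : ℝ) 1) (x : ℝ) :
    x < quantile ρ u ↔ cdf ρ x < u := by
  rw [← not_le, quantile_le_iff ρ hu, not_le]

theorem monotoneOn_quantile : MonotoneOn (quantile ρ) (Set.Ioo 0 1) := fun u hu v hv huv => by
  rw [quantile_le_iff ρ hu]
  exact huv.trans ((quantile_le_iff ρ hv _).1 le_rfl)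

theorem aemeasurable_quantile :
    AEMeasurable (quantile ρ) (volume.restrict (Set.Ioo (0 : ℝ) 1)) :=
  aemeasurable_restrict_of_monotoneOn measurableSet_Ioo (monotoneOn_quantile ρ)

theorem mallows_eq_eLpNorm :
    mallows ρ τ = eLpNorm (quantile ρ - quantile τ) 2 (volume.restrict (Set.Ioo (0 : ℝ) 1)) := by
  rw [mallows, eLpNorm_eq_lintegral_rpow_enorm_toReal (by norm_num) (by norm_num)]
  congr 1
  refine lintegral_congr fun u => ?_
  simp only [Pi.sub_apply, ENNReal.toReal_ofNat, ENNReal.rpow_ofNat]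
  rw [← sq_abs, ENNReal.ofReal_pow (abs_nonneg _), ← Real.norm_eq_abs, ofReal_norm]

theorem mallows_comm : mallows ρ τ = mallows τ ρ := by
  rw [mallows_eq_eLpNorm, mallows_eq_eLpNorm, eLpNorm_sub_comm]

theorem mallows_triangle : mallows ρ τ ≤ mallows ρ κ + mallows κ τ := by
  simp only [mallows_eq_eLpNorm]
  have := eLpNorm_add_le (p := 2)
    ((aemeasurable_quantile ρ).sub (aemeasurable_quantile κ)).aestronglyMeasurable
    ((aemeasurable_quantile κ).sub (aemeasurable_quantile τ)).aestronglyMeasurable (by norm_num)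
  simpa using this

/-- A monotone function has only countably many discontinuities. -/
theorem ae_continuousWithinAt_quantile :
    ∀ᵐ u ∂(volume.restrict (Set.Ioo (0 : ℝ) 1)),
      ContinuousWithinAt (quantile ρ) (Set.Ioo 0 1) u := by
  rw [ae_restrict_iff' measurableSet_Ioo]
  have := (monotoneOn_quantile ρ).countable_not_continuousWithinAt
  filter_upwards [this.ae_notMem volume] with u hu hmem
  by_contra h
  exact hu ⟨hmem, h⟩

variable [IsProbabilityMeasure ρ]

/-- Inverse transform sampling: within `(0, 1)`, the set where the quantile is at most `x` is `(0,
F(x)]`, of Lebesgue measure `F(x)`. -/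
theorem map_quantile : (volume.restrict (Set.Ioo (0 : ℝ) 1)).map (quantile ρ) = ρ := by
  refine (Measure.ext_of_Iic _ _ fun x => ?_).symm
  rw [Measure.map_apply_of_aemeasurable (aemeasurable_quantile ρ) measurableSet_Iic,
    Measure.restrict_apply' measurableSet_Ioo, ← ofReal_cdf]
  have h0 := cdf_nonneg ρ x
  have h1 := cdf_le_one ρ x
  have : quantile ρ ⁻¹' Set.Iic x ∩ Set.Ioo 0 1 = Set.Ioc 0 (cdf ρ x) ∩ Set.Ioo 0 1 := by
    ext u
    simp only [Set.mem_inter_iff, Set.mem_preimage, Set.mem_Iic, Set.mem_Ioc]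
    constructor
    · rintro ⟨h, hu⟩; exact ⟨⟨hu.1, (quantile_le_iff ρ hu x).1 h⟩, hu⟩
    · rintro ⟨h, hu⟩; exact ⟨(quantile_le_iff ρ hu x).2 h.2, hu⟩
  rw [this]
  refine le_antisymm ?_ ?_
  · calc ENNReal.ofReal (cdf ρ x) = volume (Set.Ioo 0 (cdf ρ x)) := by simp
      _ ≤ _ := measure_mono (show Set.Ioo 0 (cdf ρ x) ⊆
          Set.Ioc 0 (cdf ρ x) ∩ Set.Ioo 0 1 from
            fun u hu => ⟨⟨hu.1, hu.2.le⟩, hu.1, hu.2.trans_le h1⟩)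
  · calc _ ≤ volume (Set.Ioc 0 (cdf ρ x)) := measure_mono Set.inter_subset_left
      _ = _ := by simp

theorem lintegral_quantile_sq (h : Integrable (fun x => x ^ 2) ρ) :
    ∫⁻ u in Set.Ioo (0 : ℝ) 1, ENNReal.ofReal (quantile ρ u ^ 2) =
      ENNReal.ofReal (∫ x, x ^ 2 ∂ρ) := by
  rw [ofReal_integral_eq_lintegral_ofReal h (ae_of_all _ fun x => sq_nonneg x)]
  conv_rhs => rw [← map_quantile ρ]
  rw [lintegral_map' (by fun_prop) (aemeasurable_quantile ρ)]

/-- The atoms of a probability measure form a countable set, which cannot contain an interval. -/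
theorem exists_mem_Ioo_measure_singleton_eq_zero {a b : ℝ} (hab : a < b) :
    ∃ x ∈ Set.Ioo a b, ρ {x} = 0 := by
  have hc : {x : ℝ | ρ {x} ≠ 0}.Countable := by
    have := Measure.countable_meas_pos_of_disjoint_iUnion (μ := ρ) (As := fun x : ℝ => {x})
      (fun x => measurableSet_singleton x)
      (fun x y hxy => Set.disjoint_singleton.2 hxy)
    simpa [pos_iff_ne_zero] using this
  by_contra! h
  have : Set.Ioo a b ⊆ {x : ℝ | ρ {x} ≠ 0} := fun x hx => h x hx
  have h0 : volume (Set.Ioo a b) = 0 := (hc.mono this).measure_zero _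
  simp at h0
  linarith

end Quantile

/-! ### From weak convergence and second moments to Mallows convergence. -/

section Convergence

variable {ρs : ℕ → ProbabilityMeasure ℝ} {ρ : ProbabilityMeasure ℝ}

theorem tendsto_cdf_of_tendsto (h : Tendsto ρs atTop (𝓝 ρ)) {x : ℝ}
    (hx : (ρ : Measure ℝ) {x} = 0) :
    Tendsto (fun n => cdf (ρs n : Measure ℝ) x) atTop (𝓝 (cdf (ρ : Measure ℝ) x)) := by
  have := ProbabilityMeasure.tendsto_measure_of_null_frontier_of_tendsto' h (E := Set.Iic x)
    (by simpa using hx)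
  simp only [cdf_eq_real]
  exact (ENNReal.tendsto_toReal (by finiteness)).comp this

/-- Non-atoms close to the limiting quantile transfer convergence of distribution functions to
quantiles. Continuity at `u` is needed only for the upper bound, where a slightly larger `v` yields
the strict inequality `u < F(x)`. -/
theorem tendsto_quantile_of_tendsto (h : Tendsto ρs atTop (𝓝 ρ)) {u : ℝ}
    (hu : u ∈ Set.Ioo (0 : ℝ) 1)
    (hc : ContinuousWithinAt (quantile (ρ : Measure ℝ)) (Set.Ioo 0 1) u) :
    Tendsto (fun n => quantile (ρs n : Measure ℝ) u) atTop (𝓝 (quantile (ρ : Measure ℝ) u)) := by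
  rw [tendsto_order]
  constructor
  · intro a ha
    obtain ⟨x, hx, hx0⟩ := exists_mem_Ioo_measure_singleton_eq_zero (ρ : Measure ℝ) ha
    have h1 := (lt_quantile_iff (ρ : Measure ℝ) hu x).1 hx.2
    filter_upwards [(tendsto_cdf_of_tendsto h hx0).eventually_lt_const h1] with n hn
    exact hx.1.trans ((lt_quantile_iff _ hu x).2 hn)
  · intro b hb
    have hcont : ContinuousAt (quantile (ρ : Measure ℝ)) u :=
      hc.continuousAt (Ioo_mem_nhds hu.1 hu.2)
    have hev : ∀ᶠ v in 𝓝[>] u, quantile (ρ : Measure ℝ) v < b ∧ v < 1 :=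
      ((hcont.tendsto.eventually_lt_const hb).and (eventually_lt_nhds hu.2)).filter_mono
        nhdsWithin_le_nhds
    obtain ⟨v, ⟨hvb, hv1⟩, huv⟩ := (hev.and self_mem_nhdsWithin).exists
    have huv : u < v := huv
    obtain ⟨x, hx, hx0⟩ := exists_mem_Ioo_measure_singleton_eq_zero (ρ : Measure ℝ) hvb
    have h1 : u < cdf (ρ : Measure ℝ) x :=
      huv.trans_le ((quantile_le_iff _ ⟨hu.1.trans huv, hv1⟩ x).1 hx.1.le)
    filter_upwards [(tendsto_cdf_of_tendsto h hx0).eventually_const_lt h1] with n hn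
    exact ((quantile_le_iff _ hu x).2 hn.le).trans_lt hx.2

/-- Weak convergence together with convergence of the second moments implies convergence in
Mallows' distance. -/
theorem tendsto_mallows_of_tendsto (h : Tendsto ρs atTop (𝓝 ρ))
    (hi : ∀ n, Integrable (fun x => x ^ 2) (ρs n : Measure ℝ))
    (hi' : Integrable (fun x => x ^ 2) (ρ : Measure ℝ))
    (hm : Tendsto (fun n => ∫ x, x ^ 2 ∂(ρs n : Measure ℝ)) atTop
      (𝓝 (∫ x, x ^ 2 ∂(ρ : Measure ℝ)))) :
    Tendsto (fun n => mallows (ρs n : Measure ℝ) (ρ : Measure ℝ)) atTop (𝓝 0) := by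
  set lam := volume.restrict (Set.Ioo (0 : ℝ) 1)
  set q := quantile (ρ : Measure ℝ)
  set I := ∫ x, x ^ 2 ∂(ρ : Measure ℝ)
  have hI0 : 0 ≤ I := integral_nonneg fun x => sq_nonneg x
  let D : ℕ → ℝ≥0∞ := fun n =>
    ∫⁻ u, ENNReal.ofReal ((quantile (ρs n : Measure ℝ) u - q u) ^ 2) ∂lam
  let E : ℕ → ℝ≥0∞ := fun n =>
    ∫⁻ u, ENNReal.ofReal ((quantile (ρs n : Measure ℝ) u + q u) ^ 2) ∂lam
  have hqm : AEMeasurable q lam := aemeasurable_quantile _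
  -- Parallelogram identity in `L²(0, 1)`. As `D n + E n` tends to `4I`, a lower bound `4I` for
  -- `liminf E` forces `D n` to `0`, with no uniform integrability argument.
  have hsum : ∀ n, D n + E n =
      ENNReal.ofReal (2 * ∫ x, x ^ 2 ∂(ρs n : Measure ℝ)) + ENNReal.ofReal (2 * I) := by
    intro n
    have hqn : AEMeasurable (quantile (ρs n : Measure ℝ)) lam := aemeasurable_quantile _
    rw [ENNReal.ofReal_mul (by norm_num), ENNReal.ofReal_mul (by norm_num),
      ← lintegral_quantile_sq _ (hi n), ← lintegral_quantile_sq _ hi', ← lintegral_const_mul'',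
      ← lintegral_const_mul'', ← lintegral_add_left', ← lintegral_add_left']
    · refine lintegral_congr fun u => ?_
      rw [← ENNReal.ofReal_mul (by norm_num), ← ENNReal.ofReal_mul (by norm_num),
        ← ENNReal.ofReal_add (by positivity) (by positivity),
        ← ENNReal.ofReal_add (by positivity) (by positivity)]
      congr 1
      ring
    all_goals first
      | exact ((hqn.sub hqm).pow_const 2).ennreal_ofReal
      | exact ((aemeasurable_quantile _).pow_const 2).ennreal_ofReal
      | exact ((aemeasurable_quantile _).pow_const 2).ennreal_ofReal.const_mul _
  have hae : ∀ᵐ u ∂lam, Tendsto (fun n => ENNReal.ofReal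
      ((quantile (ρs n : Measure ℝ) u + q u) ^ 2)) atTop (𝓝 (ENNReal.ofReal (4 * q u ^ 2))) := by
    filter_upwards [ae_continuousWithinAt_quantile (ρ : Measure ℝ),
      ae_restrict_mem measurableSet_Ioo] with u hu hmem
    have := (((tendsto_quantile_of_tendsto h hmem hu).add_const (q u)).pow 2)
    have h2 := (ENNReal.continuous_ofReal.tendsto _).comp this
    rwa [show (quantile (ρ : Measure ℝ) u + q u) ^ 2 = 4 * q u ^ 2 by simp only [q]; ring] at h2
  have hfatou : ENNReal.ofReal (4 * I) ≤ liminf E atTop := by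
    calc ENNReal.ofReal (4 * I) = ∫⁻ u, ENNReal.ofReal (4 * q u ^ 2) ∂lam := by
          simp_rw [ENNReal.ofReal_mul (show (0 : ℝ) ≤ 4 by norm_num)]
          rw [lintegral_const_mul'' _ (by fun_prop), lintegral_quantile_sq _ hi']
      _ = ∫⁻ u, liminf (fun n => ENNReal.ofReal
            ((quantile (ρs n : Measure ℝ) u + q u) ^ 2)) atTop ∂lam := by
          refine lintegral_congr_ae ?_
          filter_upwards [hae] with u hu using hu.liminf_eq.symm
      _ ≤ _ := lintegral_liminf_le' fun n => by
          have hqn : AEMeasurable (quantile (ρs n : Measure ℝ)) lam := aemeasurable_quantile _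
          fun_prop
  have hD : Tendsto D atTop (𝓝 0) := by
    rw [ENNReal.tendsto_nhds_zero]
    intro e he
    obtain ⟨r, hr0, hre⟩ : ∃ r : ℝ, 0 < r ∧ ENNReal.ofReal r ≤ e := by
      rcases eq_or_ne e ∞ with rfl | hfin
      · exact ⟨1, one_pos, le_top⟩
      · exact ⟨e.toReal, ENNReal.toReal_pos he.ne' hfin, ENNReal.ofReal_toReal_le⟩
    have hEn : ∀ᶠ n in atTop, ENNReal.ofReal (4 * I - r / 2) ≤ E n := by
      rcases le_or_gt (4 * I - r / 2) 0 with h0 | h0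
      · exact Eventually.of_forall fun n => by simp [ENNReal.ofReal_of_nonpos h0]
      · have : ENNReal.ofReal (4 * I - r / 2) < liminf E atTop :=
          lt_of_lt_of_le ((ENNReal.ofReal_lt_ofReal_iff (by linarith)).2 (by linarith)) hfatou
        filter_upwards [eventually_lt_of_lt_liminf this] with n hn using hn.le
    -- The margins add up to `r`: `D n < 2(I + r/4) + 2I - (4I - r/2) = r`.
    filter_upwards [hEn, hm.eventually_lt_const (show I < I + r / 4 by linarith)] with n h1 h2
    have hs := hsum n
    have hM0 : 0 ≤ ∫ x, x ^ 2 ∂(ρs n : Measure ℝ) := integral_nonneg fun x => sq_nonneg x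
    rw [← ENNReal.ofReal_add (by positivity) (by positivity)] at hs
    have hDf : D n ≠ ∞ := fun hh => by simp [hh] at hs
    have hEf : E n ≠ ∞ := fun hh => by simp [hh] at hs
    refine le_trans ?_ hre
    have hs' := congrArg ENNReal.toReal hs
    rw [ENNReal.toReal_add hDf hEf, ENNReal.toReal_ofReal (by positivity)] at hs'
    have h3 := (ENNReal.ofReal_le_iff_le_toReal hEf).1 h1
    rw [← ENNReal.ofReal_toReal hDf]
    exact ENNReal.ofReal_le_ofReal (by linarith)
  have := hD.ennrpow_const (1 / 2 : ℝ)
  rwa [ENNReal.zero_rpow_of_pos (by norm_num)] at this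

end Convergence

/-! ### Taylor estimates and summability tools for characteristic functions. -/

section CharFunBounds

/-- Taylor's formula for `|x| ≤ 1`; beyond that each term is bounded separately and lower powers of
`|x|` are absorbed in the cube. The constant `4` is merely convenient. -/
theorem norm_exp_mul_I_sub_le (x : ℝ) :
    ‖Complex.exp (x * Complex.I) - (1 + x * Complex.I - x ^ 2 / 2)‖ ≤ 4 * |x| ^ 3 := by
  rcases le_or_gt |x| 1 with h | h
  · have hx : ‖(x * Complex.I : ℂ)‖ = |x| := by simp
    have := Complex.exp_bound (x := x * Complex.I) (by rwa [hx]) (n := 3) (by norm_num)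
    rw [hx] at this
    have he : ∑ m ∈ Finset.range 3, (x * Complex.I : ℂ) ^ m / (m.factorial : ℂ) =
        1 + x * Complex.I - x ^ 2 / 2 := by
      simp [Finset.sum_range_succ, mul_pow, Nat.factorial]; ring
    rw [he] at this
    refine this.trans ?_
    have h3 : 0 ≤ |x| ^ 3 := by positivity
    norm_num [Nat.factorial]
    nlinarith
  · have h1 : ‖Complex.exp (x * Complex.I)‖ = 1 := Complex.norm_exp_ofReal_mul_I x
    calc _ ≤ ‖Complex.exp (x * Complex.I)‖ + ‖(1 + x * Complex.I - x ^ 2 / 2 : ℂ)‖ :=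
          norm_sub_le _ _
      _ ≤ 1 + (1 + |x| + |x| ^ 2 / 2) := by
          rw [h1]
          gcongr
          refine (norm_sub_le _ _).trans (add_le_add ((norm_add_le _ _).trans ?_) ?_) <;> simp
      _ ≤ 4 * |x| ^ 3 := by
          have h2 : |x| ≤ |x| ^ 3 := le_self_pow₀ h.le (by norm_num)
          have h3 : |x| ^ 2 ≤ |x| ^ 3 := pow_le_pow_right₀ h.le (by norm_num)
          nlinarith

theorem abs_exp_neg_sub_le {x : ℝ} (hx : 0 ≤ x) : |Real.exp (-x) - (1 - x)| ≤ x ^ 2 := by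
  rcases le_or_gt x 1 with h | h
  · have := Real.abs_exp_sub_one_sub_id_le (x := -x) (by rwa [abs_neg, abs_of_nonneg hx])
    rw [neg_sq] at this
    convert this using 2
    ring
  · have h1 : Real.exp (-x) ≤ 1 := Real.exp_le_one_iff.2 (by linarith)
    have h2 := Real.exp_pos (-x)
    rw [abs_le]
    constructor <;> nlinarith

/-- Telescoping: the factors are exchanged one at a time, and the others have norm at most one. -/
theorem norm_prod_sub_prod_le {ι : Type*} (s : Finset ι) (a b : ι → ℂ) (ha : ∀ i, ‖a i‖ ≤ 1)
    (hb : ∀ i, ‖b i‖ ≤ 1) :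
    ‖∏ i ∈ s, a i - ∏ i ∈ s, b i‖ ≤ ∑ i ∈ s, ‖a i - b i‖ := by
  classical
  induction s using Finset.induction_on with
  | empty => simp
  | insert i s hi ih =>
    rw [Finset.prod_insert hi, Finset.prod_insert hi, Finset.sum_insert hi]
    have h1 : ‖∏ i ∈ s, a i‖ ≤ 1 := by
      rw [norm_prod]; exact Finset.prod_le_one (fun _ _ => norm_nonneg _) fun i _ => ha i
    calc _ = ‖(a i - b i) * ∏ i ∈ s, a i + b i * (∏ i ∈ s, a i - ∏ i ∈ s, b i)‖ := by
          congr 1; ring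
      _ ≤ ‖a i - b i‖ * ‖∏ i ∈ s, a i‖ + ‖b i‖ * ‖∏ i ∈ s, a i - ∏ i ∈ s, b i‖ := by
          rw [← norm_mul, ← norm_mul]; exact norm_add_le _ _
      _ ≤ ‖a i - b i‖ * 1 + 1 * ∑ i ∈ s, ‖a i - b i‖ := by
          gcongr
          exact hb i
      _ = _ := by ring

theorem ae_summable_and_integrable_tsum {α ι : Type*} [Countable ι] {_ : MeasurableSpace α}
    {m : Measure α} {F : ι → α → ℝ} (h0 : ∀ i x, 0 ≤ F i x) (hF : ∀ i, Integrable (F i) m)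
    (hs : Summable fun i => ∫ x, F i x ∂m) :
    (∀ᵐ x ∂m, Summable fun i => F i x) ∧ Integrable (fun x => ∑' i, F i x) m := by
  have hlt : ∫⁻ x, ∑' i, ENNReal.ofReal (F i x) ∂m ≠ ∞ := by
    rw [lintegral_tsum fun i => (hF i).aemeasurable.ennreal_ofReal]
    have : ∀ i, ∫⁻ x, ENNReal.ofReal (F i x) ∂m = ENNReal.ofReal (∫ x, F i x ∂m) := fun i =>
      (ofReal_integral_eq_lintegral_ofReal (hF i) (ae_of_all _ (h0 i))).symm
    simp_rw [this]
    exact hs.tsum_ofReal_ne_top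
  have hae : ∀ᵐ x ∂m, Summable fun i => F i x := by
    filter_upwards [ae_lt_top' (AEMeasurable.tsum
      fun i => (hF i).aemeasurable.ennreal_ofReal) hlt] with x hx
    have := ENNReal.summable_toReal hx.ne
    simpa [ENNReal.toReal_ofReal (h0 _ x)] using this
  refine ⟨hae, ?_, ?_⟩
  · refine (aemeasurable_of_tendsto_metrizable_ae (atTop : Filter (Finset ι))
      (f := fun s x => ∑ i ∈ s, F i x) (fun s => ?_) ?_).aestronglyMeasurable
    · exact Finset.aemeasurable_fun_sum s fun i _ => (hF i).aemeasurable
    · filter_upwards [hae] with x hx using hx.hasSum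
  · rw [hasFiniteIntegral_iff_ofReal (ae_of_all _ fun x => tsum_nonneg fun i => h0 i x)]
    refine lt_of_le_of_lt (le_of_eq (lintegral_congr_ae ?_)) (lt_top_iff_ne_top.2 hlt)
    filter_upwards [hae] with x hx
    exact ENNReal.ofReal_tsum_of_nonneg (fun i => h0 i x) hx

theorem summable_sq_of_summable_abs {w : ℤ → ℝ} (hw : Summable fun k => |w k|) :
    Summable fun k => w k ^ 2 := by
  refine Summable.of_nonneg_of_le (fun k => sq_nonneg _) (fun k => ?_) (hw.mul_left (∑' k, |w k|))
  rw [← sq_abs, sq]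
  exact mul_le_mul_of_nonneg_right (hw.le_tsum k fun _ _ => abs_nonneg _) (abs_nonneg _)

/-- Cauchy–Schwarz with weights `|w k|`. The bound does not depend on `s`, so it serves as
dominating function when finite sums are replaced by series. -/
theorem sq_sum_le_tsum {w x : ℤ → ℝ} (hw : Summable fun k => |w k|)
    (hx : Summable fun k => |w k| * x k ^ 2) (s : Finset ℤ) :
    (∑ k ∈ s, w k * x k) ^ 2 ≤ (∑' k, |w k|) * ∑' k, |w k| * x k ^ 2 := by
  calc (∑ k ∈ s, w k * x k) ^ 2 ≤ (∑ k ∈ s, |w k|) * ∑ k ∈ s, |w k| * x k ^ 2 := by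
        refine Finset.sum_sq_le_sum_mul_sum_of_sq_le_mul s (fun k _ => abs_nonneg _)
          (fun k _ => by positivity) fun k _ => le_of_eq ?_
        rw [mul_pow, ← sq_abs (w k)]; ring
    _ ≤ _ := by
        exact mul_le_mul (hw.sum_le_tsum s fun _ _ => abs_nonneg _)
          (hx.sum_le_tsum s fun _ _ => by positivity)
          (Finset.sum_nonneg fun _ _ => by positivity) (tsum_nonneg fun _ => abs_nonneg _)

end CharFunBounds

/-! ### Moments and characteristic functions of linear combinations of innovations. -/

section Innovation

variable {Ω' : Type*} [MeasurableSpace Ω'] {ε : ℤ → Ω' → ℝ} {Q : Measure Ω'} {v K : ℝ}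

namespace IsInnovation

theorem memLp_four (hε : IsInnovation ε Q v K) (t : ℤ) : MemLp (ε t) 4 Q :=
  (hε.ident t).symm.memLp_snd hε.memLp

theorem integral_eq_zero (hε : IsInnovation ε Q v K) (t : ℤ) : ∫ ω, ε t ω ∂Q = 0 :=
  (hε.ident t).integral_eq.trans hε.mean_zero

theorem integral_sq (hε : IsInnovation ε Q v K) (t : ℤ) : ∫ ω, ε t ω ^ 2 ∂Q = v :=
  ((hε.ident t).comp (u := fun x => x ^ 2) (by fun_prop)).integral_eq.trans hε.variance_eq

theorem variance_nonneg (hε : IsInnovation ε Q v K) : 0 ≤ v :=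
  hε.variance_eq ▸ integral_nonneg fun _ => sq_nonneg _

theorem fourth_bound_pos (hε : IsInnovation ε Q v K) : 0 < K :=
  lt_of_le_of_lt (integral_nonneg fun _ => by positivity) hε.fourth_lt

theorem integrable_four (hε : IsInnovation ε Q v K) : Integrable (fun ω => ε 0 ω ^ 4) Q := by
  have := hε.memLp.integrable_norm_pow (p := 4) (by norm_num)
  refine this.congr (ae_of_all _ fun ω => ?_)
  simp [Even.pow_abs (by decide : Even 4)]

variable [IsProbabilityMeasure Q]

theorem memLp_two (hε : IsInnovation ε Q v K) (t : ℤ) : MemLp (ε t) 2 Q :=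
  (hε.memLp_four t).mono_exponent (by norm_num)

theorem integrable_three (hε : IsInnovation ε Q v K) : Integrable (fun ω => |ε 0 ω| ^ 3) Q :=
  (hε.memLp.mono_exponent (q := 4) (p := 3) (by norm_num)).integrable_norm_pow
    (p := 3) (by norm_num)

/-- Jensen's inequality, read off from `E(ε² - v)² ≥ 0`. It makes every later bound depend on `K`
alone. -/
theorem variance_sq_le (hε : IsInnovation ε Q v K) : v ^ 2 ≤ K := by
  have h2 := (hε.memLp_two 0).integrable_sq
  have h4 := hε.integrable_four
  have h : 0 ≤ ∫ ω, (ε 0 ω ^ 2 - v) ^ 2 ∂Q := integral_nonneg fun _ => sq_nonneg _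
  have he : ∀ ω, (ε 0 ω ^ 2 - v) ^ 2 = ε 0 ω ^ 4 - 2 * v * ε 0 ω ^ 2 + v ^ 2 := fun ω => by ring
  simp_rw [he] at h
  have h42 : Integrable (fun ω => ε 0 ω ^ 4 - 2 * v * ε 0 ω ^ 2) Q := h4.sub (h2.const_mul _)
  rw [integral_add h42 (integrable_const _), integral_sub h4 (h2.const_mul _), integral_const_mul, hε.variance_eq] at h
  simp only [integral_const, probReal_univ, smul_eq_mul, one_mul] at h
  nlinarith [hε.fourth_lt]

theorem integral_three_le (hε : IsInnovation ε Q v K) : ∫ ω, |ε 0 ω| ^ 3 ∂Q ≤ 1 + K := by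
  calc ∫ ω, |ε 0 ω| ^ 3 ∂Q ≤ ∫ ω, (1 + ε 0 ω ^ 4) ∂Q := by
        refine integral_mono hε.integrable_three ((integrable_const _).add hε.integrable_four)
          fun ω => ?_
        have h0 := abs_nonneg (ε 0 ω)
        have h4 : ε 0 ω ^ 4 = |ε 0 ω| ^ 4 := (Even.pow_abs (by decide) _).symm
        simp only [h4]
        nlinarith [sq_nonneg (|ε 0 ω| ^ 2 - |ε 0 ω|), sq_nonneg (|ε 0 ω| ^ 2 - 1),
          sq_nonneg (|ε 0 ω|), sq_nonneg (|ε 0 ω| ^ 2)]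
    _ ≤ 1 + K := by
        rw [integral_add (integrable_const _) hε.integrable_four]
        simpa using hε.fourth_lt.le

/-- The characteristic function of an innovation is close to that of a centred Gaussian variable
of the same variance. -/
theorem norm_charFun_sub_le (hε : IsInnovation ε Q v K) (t : ℝ) :
    ‖charFun (Q.map (ε 0)) t - Complex.exp (-(v * t ^ 2 / 2 : ℝ))‖ ≤
      (1 + K) * (4 * |t| ^ 3 + t ^ 4) := by
  have hm : AEMeasurable (ε 0) Q := hε.memLp.aestronglyMeasurable.aemeasurable
  have i1 : Integrable (ε 0) Q := (hε.memLp_two 0).integrable (by norm_num)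
  have i2 : Integrable (fun ω => ε 0 ω ^ 2) Q := (hε.memLp_two 0).integrable_sq
  have hcf : charFun (Q.map (ε 0)) t = ∫ ω, Complex.exp ((t * ε 0 ω : ℝ) * Complex.I) ∂Q := by
    rw [charFun_apply_real, integral_map hm (by fun_prop)]
    push_cast
    rfl
  have j1 : Integrable (fun ω => ((t * ε 0 ω : ℝ) : ℂ) * Complex.I) Q :=
    (i1.const_mul t).ofReal.mul_const _
  have j2 : Integrable (fun ω => ((t * ε 0 ω : ℝ) : ℂ) ^ 2 / 2) Q := by
    have : Integrable (fun ω => ((t ^ 2 * ε 0 ω ^ 2 : ℝ) : ℂ) / 2) Q :=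
      (i2.const_mul (t ^ 2)).ofReal.div_const 2
    refine this.congr (ae_of_all _ fun ω => ?_)
    push_cast; ring
  have j0 : Integrable (fun ω => Complex.exp ((t * ε 0 ω : ℝ) * Complex.I)) Q := by
    refine Integrable.of_bound (C := 1) ?_ (ae_of_all _ fun ω => ?_)
    · exact (by fun_prop : Continuous fun x : ℝ => Complex.exp ((t * x : ℝ) * Complex.I)
        ).measurable.comp_aemeasurable hm |>.aestronglyMeasurable
    · rw [Complex.norm_exp_ofReal_mul_I]
  have j3 : Integrable (fun ω => 1 + ((t * ε 0 ω : ℝ) : ℂ) * Complex.I) Q :=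
    (integrable_const _).add j1
  have j4 : Integrable (fun ω => 1 + ((t * ε 0 ω : ℝ) : ℂ) * Complex.I -
    ((t * ε 0 ω : ℝ) : ℂ) ^ 2 / 2) Q := j3.sub j2
  have hq : ∫ ω, (1 + ((t * ε 0 ω : ℝ) : ℂ) * Complex.I - ((t * ε 0 ω : ℝ) : ℂ) ^ 2 / 2) ∂Q =
      ((1 - v * t ^ 2 / 2 : ℝ) : ℂ) := by
    rw [integral_sub j3 j2, integral_add (integrable_const _) j1]
    have e1 : ∫ ω, ((t * ε 0 ω : ℝ) : ℂ) * Complex.I ∂Q = 0 := by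
      rw [integral_mul_const, integral_complex_ofReal, integral_const_mul, hε.mean_zero]; simp
    have e2 : ∫ ω, ((t * ε 0 ω : ℝ) : ℂ) ^ 2 / 2 ∂Q = ((v * t ^ 2 / 2 : ℝ) : ℂ) := by
      have : ∀ ω, ((t * ε 0 ω : ℝ) : ℂ) ^ 2 / 2 = ((t ^ 2 / 2 * ε 0 ω ^ 2 : ℝ) : ℂ) := fun ω => by
        push_cast; ring
      simp_rw [this]
      rw [integral_complex_ofReal, integral_const_mul, hε.variance_eq]
      congr 1; ring
    rw [e1, e2]
    simp
  -- Both the characteristic function and the Gaussian exponential are compared with `1 - vt²/2`: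
  -- the first through the third absolute moment, the second through `v² ≤ K`.
  have hA : ‖charFun (Q.map (ε 0)) t - ((1 - v * t ^ 2 / 2 : ℝ) : ℂ)‖ ≤
      4 * |t| ^ 3 * (1 + K) := by
    rw [hcf, ← hq, ← integral_sub j0 j4]
    calc _ ≤ ∫ ω, 4 * |t| ^ 3 * |ε 0 ω| ^ 3 ∂Q := by
          refine norm_integral_le_of_norm_le (hε.integrable_three.const_mul _)
            (ae_of_all _ fun ω => ?_)
          refine (norm_exp_mul_I_sub_le _).trans (le_of_eq ?_)
          rw [abs_mul]; ring
      _ ≤ _ := by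
          rw [integral_const_mul]
          gcongr
          exact hε.integral_three_le
  have hB : ‖((1 - v * t ^ 2 / 2 : ℝ) : ℂ) - Complex.exp (-(v * t ^ 2 / 2 : ℝ))‖ ≤
      (v * t ^ 2 / 2) ^ 2 := by
    rw [← Complex.ofReal_neg, ← Complex.ofReal_exp, ← Complex.ofReal_sub, Complex.norm_real,
      Real.norm_eq_abs, abs_sub_comm]
    exact abs_exp_neg_sub_le (by have := hε.variance_nonneg; positivity)
  have hv := hε.variance_sq_le
  have h4 : 0 ≤ t ^ 4 := by positivity
  calc _ ≤ 4 * |t| ^ 3 * (1 + K) + (v * t ^ 2 / 2) ^ 2 :=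
        (norm_sub_le_norm_sub_add_norm_sub _ _ _).trans (add_le_add hA hB)
    _ ≤ _ := by
        have : (v * t ^ 2 / 2) ^ 2 = v ^ 2 * t ^ 4 / 4 := by ring
        nlinarith [mul_le_mul_of_nonneg_right hv h4, mul_nonneg hε.fourth_bound_pos.le h4]

theorem integral_sum_sq (hε : IsInnovation ε Q v K) (w : ℤ → ℝ) (s : Finset ℤ) :
    ∫ ω, (∑ k ∈ s, w k * ε k ω) ^ 2 ∂Q = v * ∑ k ∈ s, w k ^ 2 := by
  have hm : ∀ k, MemLp (fun ω => w k * ε k ω) 2 Q := fun k => (hε.memLp_two k).const_mul _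
  have hind := hε.indep.comp (fun k x => w k * x) (fun k => by fun_prop)
  have h := IndepFun.variance_sum (X := fun k ω => w k * ε k ω) (s := s) (fun k _ => hm k)
    (fun i _ j _ hij => hind.indepFun hij)
  have hz : ∀ k, ∫ ω, w k * ε k ω ∂Q = 0 := fun k => by
    rw [integral_const_mul, hε.integral_eq_zero, mul_zero]
  have hfun : (∑ k ∈ s, fun ω => w k * ε k ω) = fun ω => ∑ k ∈ s, w k * ε k ω := by
    ext ω; simp
  rw [hfun, variance_of_integral_eq_zero] at h
  · rw [h, Finset.mul_sum]
    refine Finset.sum_congr rfl fun k _ => ?_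
    rw [variance_of_integral_eq_zero (hm k).aestronglyMeasurable.aemeasurable (hz k)]
    simp_rw [mul_pow]
    rw [integral_const_mul, hε.integral_sq, mul_comm]
  · exact Finset.aemeasurable_fun_sum s fun k _ => (hm k).aestronglyMeasurable.aemeasurable
  · rw [integral_finsetSum _ fun k _ => (hm k).integrable (by norm_num)]
    exact Finset.sum_eq_zero fun k _ => hz k

/-- Independence factorizes the characteristic function, and the Gaussian exponential factorizes
likewise, so `norm_prod_sub_prod_le` reduces the bound to single innovations. -/
theorem norm_charFun_sum_sub_le (hε : IsInnovation ε Q v K) (w : ℤ → ℝ) (s : Finset ℤ) (t : ℝ) :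
    ‖charFun (Q.map fun ω => ∑ k ∈ s, w k * ε k ω) t -
      Complex.exp (-(v * (∑ k ∈ s, w k ^ 2) * t ^ 2 / 2 : ℝ))‖ ≤
      ∑ k ∈ s, (1 + K) * (4 * |w k * t| ^ 3 + (w k * t) ^ 4) := by
  have hm : ∀ k, AEMeasurable (ε k) Q := fun k => (hε.ident k).aemeasurable_fst
  have hind := hε.indep.comp (fun k x => w k * x) (fun k => by fun_prop)
  have h := iIndepFun.charFun_map_fun_finsetSum_eq_prod (P := Q) (s := s)
    (X := fun k ω => w k * ε k ω) (fun k _ => (hm k).const_mul _) (hind.restrict s)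
  have hk : ∀ k, charFun (Q.map fun ω => w k * ε k ω) t = charFun (Q.map (ε 0)) (w k * t) := by
    intro k
    rw [← charFun_map_mul, ← (hε.ident k).map_eq,
      AEMeasurable.map_map_of_aemeasurable (by fun_prop) (hm k)]
    rfl
  have hprob : IsProbabilityMeasure (Q.map (ε 0)) := Measure.isProbabilityMeasure_map (hm 0)
  have he : Complex.exp (-(v * (∑ k ∈ s, w k ^ 2) * t ^ 2 / 2 : ℝ)) =
      ∏ k ∈ s, Complex.exp (-(v * (w k * t) ^ 2 / 2 : ℝ)) := by
    rw [← Complex.exp_sum]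
    congr 1
    push_cast
    rw [Finset.sum_neg_distrib, Finset.mul_sum, Finset.sum_mul, Finset.sum_div]
    congr 1
    exact Finset.sum_congr rfl fun k _ => by ring
  rw [h, Finset.prod_apply, Finset.prod_congr rfl fun k _ => hk k, he]
  refine (norm_prod_sub_prod_le s _ _ (fun k => norm_charFun_le_one _) fun k => ?_).trans
    (Finset.sum_le_sum fun k _ => hε.norm_charFun_sub_le _)
  rw [← Complex.ofReal_neg, ← Complex.ofReal_exp, Complex.norm_real, Real.norm_eq_abs,
    abs_of_pos (Real.exp_pos _), Real.exp_le_one_iff]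
  have := hε.variance_nonneg
  have : 0 ≤ v * (w k * t) ^ 2 := by positivity
  linarith

theorem integrable_sq (hε : IsInnovation ε Q v K) (t : ℤ) :
    Integrable (fun ω => ε t ω ^ 2) Q := (hε.memLp_two t).integrable_sq

theorem ae_summable_mul_sq (hε : IsInnovation ε Q v K) {w : ℤ → ℝ} (hw : Summable fun k => |w k|) :
    (∀ᵐ ω ∂Q, Summable fun k => |w k| * ε k ω ^ 2) ∧
      Integrable (fun ω => ∑' k, |w k| * ε k ω ^ 2) Q := by
  refine ae_summable_and_integrable_tsum (fun k ω => by positivity)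
    (fun k => (hε.integrable_sq k).const_mul _) ?_
  simp_rw [integral_const_mul, hε.integral_sq]
  exact hw.mul_right v

/-- From `|wε| ≤ |w| + |w|ε²`, the right side being almost surely summable. -/
theorem ae_summable_abs (hε : IsInnovation ε Q v K) {w : ℤ → ℝ} (hw : Summable fun k => |w k|) :
    ∀ᵐ ω ∂Q, Summable fun k => |w k * ε k ω| := by
  filter_upwards [(hε.ae_summable_mul_sq hw).1] with ω hω
  refine Summable.of_nonneg_of_le (fun k => abs_nonneg _) (fun k => ?_) (hw.add hω)
  rw [abs_mul, ← sq_abs (ε k ω)]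
  nlinarith [mul_nonneg (abs_nonneg (w k)) (sq_nonneg (|ε k ω| - 1)),
    mul_nonneg (abs_nonneg (w k)) (abs_nonneg (ε k ω)), abs_nonneg (w k)]

theorem aemeasurable_tsum (hε : IsInnovation ε Q v K) {w : ℤ → ℝ} (hw : Summable fun k => |w k|) :
    AEMeasurable (fun ω => ∑' k, w k * ε k ω) Q := by
  refine aemeasurable_of_tendsto_metrizable_ae (atTop : Filter (Finset ℤ))
    (f := fun s ω => ∑ k ∈ s, w k * ε k ω) (fun s => ?_) ?_
  · exact Finset.aemeasurable_fun_sum s fun k _ => (hε.ident k).aemeasurable_fst.const_mul _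
  · filter_upwards [hε.ae_summable_abs hw] with ω hω using hω.of_abs.hasSum

theorem integrable_tsum_sq (hε : IsInnovation ε Q v K) {w : ℤ → ℝ} (hw : Summable fun k => |w k|) :
    Integrable (fun ω => (∑' k, w k * ε k ω) ^ 2) Q := by
  obtain ⟨h1, h2⟩ := hε.ae_summable_mul_sq hw
  refine (h2.const_mul (∑' k, |w k|)).mono'
    ((hε.aemeasurable_tsum hw).pow_const 2).aestronglyMeasurable ?_
  filter_upwards [h1, hε.ae_summable_abs hw] with ω hω hs
  rw [Real.norm_eq_abs, abs_of_nonneg (sq_nonneg _)]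
  exact le_of_tendsto (hs.of_abs.hasSum.pow 2) (Eventually.of_forall (sq_sum_le_tsum hw hω))

theorem integral_tsum_sq (hε : IsInnovation ε Q v K) {w : ℤ → ℝ} (hw : Summable fun k => |w k|) :
    ∫ ω, (∑' k, w k * ε k ω) ^ 2 ∂Q = v * ∑' k, w k ^ 2 := by
  obtain ⟨h1, h2⟩ := hε.ae_summable_mul_sq hw
  have hlim := tendsto_integral_filter_of_dominated_convergence (l := (atTop : Filter (Finset ℤ)))
    (F := fun s ω => (∑ k ∈ s, w k * ε k ω) ^ 2) (f := fun ω => (∑' k, w k * ε k ω) ^ 2)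
    (μ := Q) (fun ω => (∑' k, |w k|) * ∑' k, |w k| * ε k ω ^ 2)
    (Eventually.of_forall fun s => ((Finset.aemeasurable_fun_sum s fun k _ =>
      (hε.ident k).aemeasurable_fst.const_mul _).pow_const 2).aestronglyMeasurable)
    (Eventually.of_forall fun s => by
      filter_upwards [h1] with ω hω
      rw [Real.norm_eq_abs, abs_of_nonneg (sq_nonneg _)]
      exact sq_sum_le_tsum hw hω s)
    (h2.const_mul _)
    (by filter_upwards [hε.ae_summable_abs hw] with ω hω using hω.of_abs.hasSum.pow 2)
  simp_rw [hε.integral_sum_sq] at hlim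
  exact tendsto_nhds_unique hlim (Tendsto.const_mul v (summable_sq_of_summable_abs hw).hasSum)

/-- Berry-Esseen type bound for the characteristic function of an infinite linear combination of
innovations with uniformly small weights. -/
theorem norm_charFun_tsum_sub_le (hε : IsInnovation ε Q v K) {w : ℤ → ℝ}
    (hw : Summable fun k => |w k|) {b : ℝ} (hb : ∀ k, |w k| ≤ b) (t : ℝ) :
    ‖charFun (Q.map fun ω => ∑' k, w k * ε k ω) t -
      Complex.exp (-(v * (∑' k, w k ^ 2) * t ^ 2 / 2 : ℝ))‖ ≤
      (1 + K) * (4 * b * |t| ^ 3 + b ^ 2 * t ^ 4) * ∑' k, w k ^ 2 := by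
  have hsq := summable_sq_of_summable_abs hw
  have hK := hε.fourth_bound_pos
  have hb0 : 0 ≤ b := (abs_nonneg _).trans (hb 0)
  have hcf : ∀ f : Ω' → ℝ, AEMeasurable f Q →
      charFun (Q.map f) t = ∫ ω, Complex.exp (t * f ω * Complex.I) ∂Q := fun f hf => by
    rw [charFun_apply_real, integral_map hf (by fun_prop)]
  have hms : ∀ s : Finset ℤ, AEMeasurable (fun ω => ∑ k ∈ s, w k * ε k ω) Q := fun s =>
    Finset.aemeasurable_fun_sum s fun k _ => (hε.ident k).aemeasurable_fst.const_mul _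
  have hcont : Continuous fun x : ℝ => Complex.exp (t * x * Complex.I) := by fun_prop
  have hlim : Tendsto (fun s : Finset ℤ => charFun (Q.map fun ω => ∑ k ∈ s, w k * ε k ω) t) atTop
      (𝓝 (charFun (Q.map fun ω => ∑' k, w k * ε k ω) t)) := by
    simp_rw [hcf _ (hms _), hcf _ (hε.aemeasurable_tsum hw)]
    refine tendsto_integral_filter_of_dominated_convergence (fun _ => 1)
      (Eventually.of_forall fun s =>
        (hcont.measurable.comp_aemeasurable (hms s)).aestronglyMeasurable)
      (Eventually.of_forall fun s => ae_of_all _ fun ω => ?_) (integrable_const _) ?_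
    · rw [← Complex.ofReal_mul, Complex.norm_exp_ofReal_mul_I]
    · filter_upwards [hε.ae_summable_abs hw] with ω hω
      exact (hcont.tendsto _).comp hω.of_abs.hasSum
  have hexp : Tendsto (fun s : Finset ℤ =>
      Complex.exp (-(v * (∑ k ∈ s, w k ^ 2) * t ^ 2 / 2 : ℝ))) atTop
      (𝓝 (Complex.exp (-(v * (∑' k, w k ^ 2) * t ^ 2 / 2 : ℝ)))) :=
    ((by fun_prop : Continuous fun x : ℝ => Complex.exp (-(v * x * t ^ 2 / 2 : ℝ))).tendsto _).comp
      hsq.hasSum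
  refine le_of_tendsto (hlim.sub hexp).norm (Eventually.of_forall fun s => ?_)
  refine (hε.norm_charFun_sum_sub_le w s t).trans ?_
  calc _ ≤ ∑ k ∈ s, (1 + K) * (4 * b * |t| ^ 3 + b ^ 2 * t ^ 4) * w k ^ 2 := by
        refine Finset.sum_le_sum fun k _ => ?_
        rw [abs_mul, mul_assoc]
        refine mul_le_mul_of_nonneg_left ?_ (by positivity)
        -- Only two factors `|w k|` are kept for the sum of squares; the surplus ones are replaced
        -- by the uniform bound `b`, the source of the smallness.
        have e1 : |w k| ^ 3 ≤ b * w k ^ 2 := by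
          rw [← sq_abs, pow_succ' |w k| 2]
          exact mul_le_mul_of_nonneg_right (hb k) (by positivity)
        have e2 : w k ^ 4 ≤ b ^ 2 * w k ^ 2 := by
          rw [show w k ^ 4 = |w k| ^ 2 * w k ^ 2 by rw [sq_abs]; ring]
          exact mul_le_mul_of_nonneg_right (pow_le_pow_left₀ (abs_nonneg _) (hb k) 2)
            (sq_nonneg _)
        have e3 := mul_le_mul_of_nonneg_right e1 (show 0 ≤ |t| ^ 3 by positivity)
        have e4 := mul_le_mul_of_nonneg_right e2 (show 0 ≤ t ^ 4 by positivity)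
        rw [mul_pow, mul_pow]
        linarith
    _ ≤ _ := by
        rw [← Finset.mul_sum]
        exact mul_le_mul_of_nonneg_left (hsq.sum_le_tsum s fun _ _ => sq_nonneg _) (by positivity)

end IsInnovation
end Innovation

/-! ### The Wold recursion and the exponential of a power series. -/

section WoldRecursion

theorem woldRec_zero (a : ℕ → ℝ) : woldRec a 0 = 1 := by rw [woldRec]

/-- Multiplying by `k + 1` turns the weight `1 - j/(k+1)` into `k + 1 - j`; the result is the
coefficient form of the differential equation `C' = A' C`. -/
theorem woldRec_succ (a : ℕ → ℝ) (k : ℕ) :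
    ((k : ℝ) + 1) * woldRec a (k + 1) =
      ∑ p ∈ Finset.HasAntidiagonal.antidiagonal k, ((p.1 : ℝ) + 1) * a (p.1 + 1) * woldRec a p.2 := by
  rw [woldRec, ← Finset.Nat.sum_antidiagonal_swap, Finset.Nat.sum_antidiagonal_eq_sum_range_succ_mk,
    Finset.sum_range, Finset.mul_sum]
  refine Finset.sum_congr rfl fun j _ => ?_
  have hj : (j : ℕ) ≤ k := Nat.lt_succ_iff.1 j.isLt
  have hk : (k : ℝ) + 1 ≠ 0 := by positivity
  simp only [Prod.fst_swap, Prod.snd_swap]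
  rw [show k + 1 - (j : ℕ) = k - j + 1 by omega, Nat.cast_sub hj]
  field_simp
  ring

theorem summable_mul_pow_pred (M : ℝ) {r : ℝ} (h0 : 0 ≤ r)
    (h1 : r < 1) : Summable fun k : ℕ => M * (k * r ^ (k - 1)) := by
  refine Summable.mul_left M ?_
  rw [← summable_nat_add_iff 1]
  simp only [Nat.add_sub_cancel, Nat.cast_add, Nat.cast_one, add_mul, one_mul]
  refine Summable.add ?_ (summable_geometric_of_lt_one h0 h1)
  simpa using summable_pow_mul_geometric_of_norm_lt_one 1 (r := r)
    (by rwa [Real.norm_eq_abs, abs_of_nonneg h0])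

theorem summable_norm_mul_pow {b : ℕ → ℂ} {M : ℝ} (hb : ∀ k, ‖b k‖ ≤ M) {z : ℂ} (hz : ‖z‖ < 1) :
    Summable fun k : ℕ => ‖b k * z ^ k‖ := by
  refine Summable.of_nonneg_of_le (fun _ => norm_nonneg _) (fun k => ?_)
    ((summable_geometric_of_lt_one (norm_nonneg z) hz).mul_left M)
  rw [norm_mul, norm_pow]
  exact mul_le_mul_of_nonneg_right (hb k) (by positivity)

theorem summable_norm_succ_mul_pow {b : ℕ → ℂ} {M : ℝ} (hb : ∀ k, ‖b k‖ ≤ M) {z : ℂ}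
    (hz : ‖z‖ < 1) : Summable fun k : ℕ => ‖((k : ℂ) + 1) * b (k + 1) * z ^ k‖ := by
  refine Summable.of_nonneg_of_le (fun _ => norm_nonneg _) (fun k => ?_)
    ((summable_nat_add_iff 1).2 (summable_mul_pow_pred M (norm_nonneg z) hz))
  rw [norm_mul, norm_mul, norm_pow]
  have : ‖(k : ℂ) + 1‖ = ((k + 1 : ℕ) : ℝ) := by
    rw [← Nat.cast_succ, Complex.norm_natCast]
  rw [this, Nat.add_sub_cancel, mul_comm _ ‖b (k + 1)‖, mul_assoc]
  exact mul_le_mul_of_nonneg_right (hb _) (by positivity)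

theorem hasDerivAt_tsum_mul_pow {b : ℕ → ℂ} {M : ℝ} (hb : ∀ k, ‖b k‖ ≤ M) {z : ℂ} (hz : ‖z‖ < 1) :
    HasDerivAt (fun z => ∑' k, b k * z ^ k) (∑' k : ℕ, ((k : ℂ) + 1) * b (k + 1) * z ^ k) z := by
  obtain ⟨r, hzr, hr1⟩ := exists_between hz
  have hr0 : 0 ≤ r := (norm_nonneg z).trans hzr.le
  have hM : 0 ≤ M := (norm_nonneg _).trans (hb 0)
  have h := hasDerivAt_tsum_of_isPreconnected (summable_mul_pow_pred M hr0 hr1)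
    Metric.isOpen_ball (convex_ball (0 : ℂ) r).isPreconnected
    (g := fun k z => b k * z ^ k) (g' := fun k z => b k * (k * z ^ (k - 1)))
    (fun k y _ => (hasDerivAt_pow k y).const_mul (b k))
    (fun k y hy => ?_) (Metric.mem_ball_self (lt_of_le_of_lt (norm_nonneg z) hzr))
    (summable_norm_mul_pow hb (z := 0) (by simp)).of_norm (y := z) (by simpa using hzr)
  · refine h.congr_deriv ?_
    rw [Summable.tsum_eq_zero_add (f := fun k : ℕ => b k * (k * z ^ (k - 1)))]
    · simp only [CharP.cast_eq_zero, zero_mul, mul_zero, zero_add, Nat.add_sub_cancel]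
      refine tsum_congr fun k => ?_
      push_cast
      ring
    · rw [← summable_nat_add_iff 1]
      refine (summable_norm_succ_mul_pow hb hz).of_norm.congr fun k => ?_
      simp only [Nat.add_sub_cancel]
      push_cast
      ring
  · rw [norm_mul, norm_mul, norm_pow, Complex.norm_natCast]
    have : ‖y‖ ≤ r := by simpa using (Metric.mem_ball.1 hy).le
    gcongr
    exact hb k

/-- The Wold recursion computes the coefficients of the exponential of a power series. -/
theorem tsum_woldRec_mul_pow {a : ℕ → ℝ} {M N : ℝ} (ha : ∀ k, |a k| ≤ M)
    (hc : ∀ k, |woldRec a k| ≤ N) {z : ℂ} (hz : ‖z‖ < 1) :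
    ∑' k, (woldRec a k : ℂ) * z ^ k = Complex.exp (∑' k, (a (k + 1) : ℂ) * z ^ (k + 1)) := by
  have hM : 0 ≤ M := (abs_nonneg _).trans (ha 0)
  -- The constant term is removed from the exponent, in accordance with `c_0 = 1`; `a 0` enters only
  -- through the innovation variance.
  let b : ℕ → ℂ := fun k => if k = 0 then 0 else (a k : ℂ)
  have hb : ∀ k, ‖b k‖ ≤ M := fun k => by
    rcases eq_or_ne k 0 with h | h
    · simpa [b, h] using hM
    · simpa [b, h] using ha k
  have hbs : ∀ k, b (k + 1) = a (k + 1) := fun k => by simp [b]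
  have hc' : ∀ k, ‖(woldRec a k : ℂ)‖ ≤ N := fun k => by simpa using hc k
  have hA : ∀ z : ℂ, ‖z‖ < 1 → ∑' k, b k * z ^ k = ∑' k, (a (k + 1) : ℂ) * z ^ (k + 1) :=
    fun z hz => by
      rw [(summable_norm_mul_pow hb hz).of_norm.tsum_eq_zero_add]
      simp [b]
  -- The recursion gives `C' = A' C`, hence `C exp(-A)` has zero derivative on the disc and keeps
  -- its value `1` at the origin.
  have hder : ∀ z : ℂ, ‖z‖ < 1 →
      HasDerivAt (fun z => (∑' k, (woldRec a k : ℂ) * z ^ k) * Complex.exp (-∑' k, b k * z ^ k))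
        0 z := fun z hz => by
    have h1 := hasDerivAt_tsum_mul_pow hc' hz
    have h2 := hasDerivAt_tsum_mul_pow hb hz
    have h3 : ∑' k : ℕ, ((k : ℂ) + 1) * (woldRec a (k + 1) : ℂ) * z ^ k =
        (∑' k : ℕ, ((k : ℂ) + 1) * b (k + 1) * z ^ k) * ∑' k, (woldRec a k : ℂ) * z ^ k := by
      rw [tsum_mul_tsum_eq_tsum_sum_antidiagonal_of_summable_norm
        (summable_norm_succ_mul_pow hb hz) (summable_norm_mul_pow hc' hz)]
      refine tsum_congr fun k => ?_
      have := congrArg (fun x : ℝ => (x : ℂ)) (woldRec_succ a k)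
      push_cast at this
      rw [this, Finset.sum_mul]
      refine Finset.sum_congr rfl fun p hp => ?_
      rw [← Finset.HasAntidiagonal.mem_antidiagonal.1 hp, hbs, pow_add]
      ring
    refine (h1.mul h2.neg.cexp).congr_deriv ?_
    rw [h3]
    ring
  have hconst := (Metric.isOpen_ball (x := (0 : ℂ)) (ε := 1)).is_const_of_deriv_eq_zero
    (convex_ball (0 : ℂ) 1).isPreconnected
    (fun z hz => (hder z (by simpa using hz)).differentiableAt.differentiableWithinAt)
    (fun z hz => (hder z (by simpa using hz)).deriv)
    (show z ∈ Metric.ball (0 : ℂ) 1 by simpa using hz)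
    (Metric.mem_ball_self one_pos)
  have h0 : ∀ b : ℕ → ℂ, ∑' k, b k * (0 : ℂ) ^ k = b 0 := fun b => by
    rw [tsum_eq_single 0 fun k hk => by simp [hk]]; simp
  simp only [h0, woldRec_zero, hA z hz] at hconst
  rw [Complex.exp_neg] at hconst
  have hne := Complex.exp_ne_zero (∑' k, (a (k + 1) : ℂ) * z ^ (k + 1))
  field_simp at hconst
  simpa [b] using hconst

end WoldRecursion

/-! ### Poisson integrals on the circle and their convergence in `L¹`. -/

section PoissonMeans

open AddCircle

variable {T : ℝ}

/-- The Poisson kernel of the circle, as a Fourier series. -/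
def circlePoisson (r : ℝ) (x : AddCircle T) : ℂ := ∑' k : ℤ, (r : ℂ) ^ k.natAbs * fourier k x

variable {r : ℝ}

theorem summable_pow_natAbs (h0 : 0 ≤ r) (h1 : r < 1) : Summable fun k : ℤ => r ^ k.natAbs :=
  Summable.of_nat_of_neg (by simpa using summable_geometric_of_lt_one h0 h1)
    (by simpa using summable_geometric_of_lt_one h0 h1)

theorem norm_fourier_apply (k : ℤ) (x : AddCircle T) : ‖fourier k x‖ = 1 := Circle.norm_coe _

theorem norm_circlePoisson_term (h0 : 0 ≤ r) (k : ℤ) (x : AddCircle T) :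
    ‖(r : ℂ) ^ k.natAbs * fourier k x‖ = r ^ k.natAbs := by
  rw [norm_mul, norm_fourier_apply, norm_pow, Complex.norm_real, Real.norm_eq_abs,
    abs_of_nonneg h0, mul_one]

theorem summable_circlePoisson (h0 : 0 ≤ r) (h1 : r < 1) (x : AddCircle T) :
    Summable fun k : ℤ => (r : ℂ) ^ k.natAbs * fourier k x := by
  refine Summable.of_norm ?_
  simp_rw [norm_circlePoisson_term h0]
  exact summable_pow_natAbs h0 h1

theorem continuous_circlePoisson (h0 : 0 ≤ r) (h1 : r < 1) :
    Continuous (circlePoisson r : AddCircle T → ℂ) :=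
  continuous_tsum (fun k => by fun_prop) (summable_pow_natAbs h0 h1)
    fun k x => (norm_circlePoisson_term h0 k x).le

theorem norm_circlePoisson_le (h0 : 0 ≤ r) (h1 : r < 1) (x : AddCircle T) :
    ‖circlePoisson r x‖ ≤ ∑' k : ℤ, r ^ k.natAbs := by
  have h := summable_circlePoisson h0 h1 x
  refine (norm_tsum_le_tsum_norm ?_).trans (le_of_eq ?_) <;> simp_rw [norm_circlePoisson_term h0]
  exact summable_pow_natAbs h0 h1

theorem fourier_natCast (k : ℕ) (x : AddCircle T) : fourier (k : ℤ) x = (fourier 1 x) ^ k := by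
  induction k with
  | zero => simp
  | succ k ih => rw [Nat.cast_succ, fourier_add, ih, pow_succ]

/-- The Poisson kernel is nonnegative. -/
theorem circlePoisson_eq_ofReal (h0 : 0 ≤ r) (h1 : r < 1) (x : AddCircle T) :
    circlePoisson r x = ((1 - r ^ 2) / Complex.normSq (1 - r * fourier 1 x) : ℝ) := by
  set w : ℂ := fourier 1 x with hw
  have hwn : ‖w‖ = 1 := norm_fourier_apply 1 x
  have hww : w * (starRingEnd ℂ) w = 1 := by
    rw [Complex.mul_conj, Complex.normSq_eq_norm_sq, hwn]; norm_num
  have hz : ‖(r : ℂ) * w‖ < 1 := by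
    rwa [norm_mul, hwn, mul_one, Complex.norm_real, Real.norm_eq_abs, abs_of_nonneg h0]
  have hz' : ‖(r : ℂ) * (starRingEnd ℂ) w‖ < 1 := by
    rw [norm_mul, RCLike.norm_conj, ← norm_mul]; exact hz
  have hn1 : 1 - (r : ℂ) * w ≠ 0 := by
    intro h
    rw [← sub_eq_zero.1 h, norm_one] at hz
    exact lt_irrefl _ hz
  have hn2 : 1 - (r : ℂ) * (starRingEnd ℂ) w ≠ 0 := by
    intro h
    rw [← sub_eq_zero.1 h, norm_one] at hz'
    exact lt_irrefl _ hz'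
  have hp : ∀ k : ℕ, (r : ℂ) ^ (k : ℤ).natAbs * fourier (k : ℤ) x = (r * w) ^ k := fun k => by
    rw [Int.natAbs_natCast, fourier_natCast, mul_pow]
  have hm : ∀ k : ℕ, (r : ℂ) ^ (-((k : ℤ) + 1)).natAbs * fourier (-((k : ℤ) + 1)) x =
      (r * (starRingEnd ℂ) w) * (r * (starRingEnd ℂ) w) ^ k := fun k => by
    rw [Int.natAbs_neg, fourier_neg, ← Nat.cast_succ, fourier_natCast, Int.natAbs_natCast,
      map_pow, ← mul_pow, pow_succ']
  have hsum := HasSum.of_nat_of_neg_add_one (f := fun k : ℤ => (r : ℂ) ^ k.natAbs * fourier k x)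
    (by simp_rw [hp]; exact hasSum_geometric_of_norm_lt_one hz)
    (by simp_rw [hm]; exact (hasSum_geometric_of_norm_lt_one hz').mul_left _)
  rw [circlePoisson, hsum.tsum_eq]
  have hns : ((Complex.normSq (1 - r * w) : ℝ) : ℂ) =
      (1 - r * w) * (1 - r * (starRingEnd ℂ) w) := by
    rw [← Complex.mul_conj]; simp
  push_cast
  rw [hns]
  field_simp
  linear_combination (-(r : ℂ) ^ 2) * hww

/-- Positivity is what gives the kernel `L¹` norm equal to its integral, namely one. -/
theorem norm_circlePoisson (h0 : 0 ≤ r) (h1 : r < 1) (x : AddCircle T) :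
    (‖circlePoisson r x‖ : ℂ) = circlePoisson r x := by
  rw [circlePoisson_eq_ofReal h0 h1, Complex.norm_real, Real.norm_eq_abs, abs_of_nonneg]
  have : 0 ≤ Complex.normSq (1 - r * fourier 1 x) := Complex.normSq_nonneg _
  have : 0 ≤ 1 - r ^ 2 := by nlinarith
  positivity

variable [hT : Fact (0 < T)]

theorem integrable_of_continuous {f : AddCircle T → ℂ} (hf : Continuous f) :
    Integrable f haarAddCircle :=
  hf.integrable_of_hasCompactSupport (HasCompactSupport.of_compactSpace _)

theorem integral_circlePoisson (h0 : 0 ≤ r) (h1 : r < 1) :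
    ∫ x : AddCircle T, circlePoisson r x ∂haarAddCircle = 1 := by
  have hs : Summable fun k : ℤ =>
      ∫ x : AddCircle T, ‖(r : ℂ) ^ k.natAbs * fourier k x‖ ∂haarAddCircle := by
    simp_rw [norm_circlePoisson_term h0]
    simpa using summable_pow_natAbs h0 h1
  have := hasSum_integral_of_summable_integral_norm
    (fun k => integrable_of_continuous (by fun_prop)) hs
  rw [show (fun x : AddCircle T => ∑' k : ℤ, (r : ℂ) ^ k.natAbs * fourier k x) = circlePoisson r
    from rfl] at this
  rw [← this.tsum_eq, tsum_eq_single 0]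
  · simp
  · intro k hk
    rw [integral_const_mul]
    have : ∫ x : AddCircle T, fourier k x ∂haarAddCircle = fourierCoeff (T := T) (fourier k) 0 := by
      simp [fourierCoeff]
    rw [this, fourierCoeff_fourier]
    simp [hk.symm]

theorem lintegral_enorm_circlePoisson (h0 : 0 ≤ r) (h1 : r < 1) :
    ∫⁻ x : AddCircle T, ‖circlePoisson r x‖ₑ ∂haarAddCircle = 1 := by
  have hi := integrable_of_continuous (T := T) (continuous_circlePoisson h0 h1)
  have h := integral_circlePoisson (T := T) h0 h1
  have h2 : ∫ x : AddCircle T, ‖circlePoisson r x‖ ∂haarAddCircle = 1 := by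
    have : ∫ x : AddCircle T, (‖circlePoisson r x‖ : ℂ) ∂haarAddCircle = 1 := by
      simp_rw [norm_circlePoisson h0 h1]; exact h
    rw [integral_complex_ofReal] at this
    exact_mod_cast this
  rw [← ofReal_integral_norm_eq_lintegral_enorm hi, h2, ENNReal.ofReal_one]

/-- The Poisson integral of a function on the circle. -/
def poissonMean (r : ℝ) (u : AddCircle T → ℂ) (x : AddCircle T) : ℂ :=
  ∫ y, circlePoisson r (x - y) * u y ∂haarAddCircle

theorem integrable_circlePoisson_mul (h0 : 0 ≤ r) (h1 : r < 1) {u : AddCircle T → ℂ}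
    (hu : Integrable u haarAddCircle) (x : AddCircle T) :
    Integrable (fun y => circlePoisson r (x - y) * u y) haarAddCircle :=
  hu.bdd_mul (((continuous_circlePoisson h0 h1).comp (by fun_prop)).aestronglyMeasurable)
    (ae_of_all _ fun y => norm_circlePoisson_le h0 h1 (x - y))

theorem continuous_poissonMean (h0 : 0 ≤ r) (h1 : r < 1) {u : AddCircle T → ℂ}
    (hu : Integrable u haarAddCircle) : Continuous (poissonMean r u) := by
  refine continuous_of_dominated
    (fun x => (integrable_circlePoisson_mul h0 h1 hu x).aestronglyMeasurable)
    (bound := fun y => (∑' k : ℤ, r ^ k.natAbs) * ‖u y‖) (fun x => ae_of_all _ fun y => ?_)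
    (hu.norm.const_mul _) (ae_of_all _ fun y => ?_)
  · rw [norm_mul]
    exact mul_le_mul_of_nonneg_right (norm_circlePoisson_le h0 h1 _) (norm_nonneg _)
  · exact ((continuous_circlePoisson h0 h1).comp (by fun_prop)).mul_const _

theorem poissonMean_sub (h0 : 0 ≤ r) (h1 : r < 1) {u v : AddCircle T → ℂ}
    (hu : Integrable u haarAddCircle) (hv : Integrable v haarAddCircle) :
    poissonMean r (u - v) = poissonMean r u - poissonMean r v := by
  ext x
  simp only [poissonMean, Pi.sub_apply, mul_sub]
  exact integral_sub (integrable_circlePoisson_mul h0 h1 hu x)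
    (integrable_circlePoisson_mul h0 h1 hv x)

theorem poissonMean_add (h0 : 0 ≤ r) (h1 : r < 1) {u v : AddCircle T → ℂ}
    (hu : Integrable u haarAddCircle) (hv : Integrable v haarAddCircle) :
    poissonMean r (u + v) = poissonMean r u + poissonMean r v := by
  ext x
  simp only [poissonMean, Pi.add_apply, mul_add]
  exact integral_add (integrable_circlePoisson_mul h0 h1 hu x)
    (integrable_circlePoisson_mul h0 h1 hv x)

theorem poissonMean_smul (c : ℂ) (u : AddCircle T → ℂ) :
    poissonMean r (c • u) = c • poissonMean r u := by
  ext x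
  simp only [poissonMean, Pi.smul_apply, smul_eq_mul, ← integral_const_mul]
  exact integral_congr_ae (ae_of_all _ fun y => by ring)

/-- Integrating the kernel series term by term multiplies the `k`-th Fourier coefficient by `r^|k|`.
-/
theorem hasSum_poissonMean (h0 : 0 ≤ r) (h1 : r < 1) {u : AddCircle T → ℂ}
    (hu : Integrable u haarAddCircle) (x : AddCircle T) :
    HasSum (fun k : ℤ => (r : ℂ) ^ k.natAbs * fourierCoeff u k * fourier k x)
      (poissonMean r u x) := by
  have hF : ∀ (k : ℤ) y, (r : ℂ) ^ k.natAbs * fourier k (x - y) * u y =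
      (r : ℂ) ^ k.natAbs * fourier k x * (fourier (-k) y • u y) := fun k y => by
    have : fourier k (x - y) = fourier k x * fourier (-k) y := by
      rw [fourier_apply, fourier_apply, fourier_apply, sub_eq_add_neg, smul_add, smul_neg,
        toCircle_add, Circle.coe_mul, neg_smul]
    rw [this, smul_eq_mul]; ring
  have hn : ∀ (k : ℤ) y, ‖(r : ℂ) ^ k.natAbs * fourier k (x - y) * u y‖ = r ^ k.natAbs * ‖u y‖ :=
    fun k y => by rw [norm_mul, norm_circlePoisson_term h0]
  have := hasSum_integral_of_summable_integral_norm (μ := haarAddCircle (T := T))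
    (F := fun (k : ℤ) y => (r : ℂ) ^ k.natAbs * fourier k (x - y) * u y)
    (fun k => by
      simp_rw [hF]
      exact (hu.fourier_smul _).const_mul _)
    (by
      simp_rw [hn, integral_const_mul]
      exact (summable_pow_natAbs h0 h1).mul_right _)
  have hk : ∀ k : ℤ, ∫ y, (r : ℂ) ^ k.natAbs * fourier k (x - y) * u y ∂haarAddCircle =
      (r : ℂ) ^ k.natAbs * fourierCoeff u k * fourier k x := fun k => by
    simp_rw [hF]
    rw [integral_const_mul, fourierCoeff]
    ring
  simp_rw [tsum_mul_right, hk] at this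
  exact this

theorem poissonMean_fourier (h0 : 0 ≤ r) (h1 : r < 1) (j : ℤ) :
    poissonMean r (fourier j : AddCircle T → ℂ) = (r : ℂ) ^ j.natAbs • (fourier j : _ → ℂ) := by
  ext x
  have := hasSum_poissonMean h0 h1 (integrable_of_continuous (fourier (T := T) j).continuous) x
  rw [← this.tsum_eq, fourierCoeff_fourier, tsum_eq_single j]
  · simp
  · intro k hk
    simp [hk]

/-- Tonelli and translation invariance, for a kernel of `L¹` norm one. The contraction is uniform in
`r`, which allows passage from trigonometric polynomials to `L¹`. -/
theorem eLpNorm_poissonMean_le (h0 : 0 ≤ r) (h1 : r < 1) {u : AddCircle T → ℂ}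
    (hu : Integrable u haarAddCircle) :
    eLpNorm (poissonMean r u) 1 haarAddCircle ≤ eLpNorm u 1 haarAddCircle := by
  rw [eLpNorm_one_eq_lintegral_enorm, eLpNorm_one_eq_lintegral_enorm]
  have hm : AEMeasurable (fun p : AddCircle T × AddCircle T =>
      ‖circlePoisson r (p.1 - p.2)‖ₑ * ‖u p.2‖ₑ) (haarAddCircle.prod haarAddCircle) :=
    ((continuous_circlePoisson h0 h1).comp (by fun_prop)).enorm.aemeasurable.mul
      hu.aestronglyMeasurable.comp_snd.enorm
  calc ∫⁻ x, ‖poissonMean r u x‖ₑ ∂haarAddCircle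
      ≤ ∫⁻ x, ∫⁻ y, ‖circlePoisson r (x - y)‖ₑ * ‖u y‖ₑ ∂haarAddCircle ∂haarAddCircle := by
        refine lintegral_mono fun x => (enorm_integral_le_lintegral_enorm _).trans (le_of_eq ?_)
        simp_rw [enorm_mul]
    _ = ∫⁻ y, ∫⁻ x, ‖circlePoisson r (x - y)‖ₑ * ‖u y‖ₑ ∂haarAddCircle ∂haarAddCircle :=
        lintegral_lintegral_swap hm
    _ = ∫⁻ y, ‖u y‖ₑ ∂haarAddCircle := by
        refine lintegral_congr fun y => ?_
        have hc : Continuous fun x => circlePoisson r (x - y) :=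
          (continuous_circlePoisson h0 h1).comp (by fun_prop)
        rw [lintegral_mul_const'' _ hc.enorm.aemeasurable,
          lintegral_sub_right_eq_self (fun x => ‖circlePoisson r x‖ₑ) y,
          lintegral_enorm_circlePoisson h0 h1, one_mul]

theorem tendsto_eLpNorm_poissonMean_sub_of_mem_span {p : C(AddCircle T, ℂ)}
    (hp : p ∈ Submodule.span ℂ (Set.range (@fourier T))) :
    Tendsto (fun r => eLpNorm (poissonMean r p - ⇑p) 1 haarAddCircle) (𝓝[Set.Ico 0 1] 1)
      (𝓝 0) := by
  have hint : ∀ q : C(AddCircle T, ℂ), Integrable q haarAddCircle := fun q =>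
    integrable_of_continuous q.continuous
  induction hp using Submodule.span_induction with
  | mem p hp =>
    obtain ⟨j, rfl⟩ := hp
    have h : Tendsto (fun r : ℝ => ‖(r : ℂ) ^ j.natAbs - 1‖ₑ *
        eLpNorm (fourier (T := T) j) 1 haarAddCircle) (𝓝[Set.Ico 0 1] 1) (𝓝 0) := by
      have hc : Continuous fun r : ℝ => ‖(r : ℂ) ^ j.natAbs - 1‖ₑ := by fun_prop
      have := ENNReal.Tendsto.mul_const (b := eLpNorm (fourier (T := T) j) 1 haarAddCircle)
        ((hc.tendsto 1).mono_left (nhdsWithin_le_nhds (s := Set.Ico 0 1)))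
        (Or.inr (memLp_one_iff_integrable.2 (hint (fourier j))).eLpNorm_ne_top)
      simpa using this
    refine h.congr' ?_
    filter_upwards [self_mem_nhdsWithin] with r hr
    rw [poissonMean_fourier hr.1 hr.2, ← eLpNorm_const_smul, sub_smul, one_smul]
  | zero =>
    refine tendsto_const_nhds.congr fun r => ?_
    have : poissonMean r ((0 : C(AddCircle T, ℂ)) : AddCircle T → ℂ) = 0 := by
      ext x; simp [poissonMean]
    rw [this]; simp
  | add p q _ _ ihp ihq =>
    have h := ihp.add ihq
    rw [add_zero] at h
    refine tendsto_of_tendsto_of_tendsto_of_le_of_le' tendsto_const_nhds h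
      (Eventually.of_forall fun _ => zero_le) ?_
    filter_upwards [self_mem_nhdsWithin] with r hr
    rw [ContinuousMap.coe_add, poissonMean_add hr.1 hr.2 (hint p) (hint q), add_sub_add_comm]
    exact eLpNorm_add_le
      ((continuous_poissonMean hr.1 hr.2 (hint p)).sub p.continuous).aestronglyMeasurable
      ((continuous_poissonMean hr.1 hr.2 (hint q)).sub q.continuous).aestronglyMeasurable le_rfl
  | smul c p _ ih =>
    have h := ENNReal.Tendsto.const_mul ih (Or.inr (enorm_ne_top (x := c)))
    rw [mul_zero] at h
    refine h.congr fun r => ?_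
    rw [ContinuousMap.coe_smul, poissonMean_smul, ← smul_sub, eLpNorm_const_smul]

/-- Continuous functions are dense in `L¹`, and trigonometric polynomials are uniformly dense among
them; on a probability space the sup norm bounds the `L¹` norm. -/
theorem exists_mem_span_fourier_eLpNorm_sub_le {u : AddCircle T → ℂ}
    (hu : Integrable u haarAddCircle) {η : ℝ≥0∞} (hη : η ≠ 0) :
    ∃ p ∈ Submodule.span ℂ (Set.range (@fourier T)), eLpNorm (u - ⇑p) 1 haarAddCircle ≤ η := by
  have hη2 : η / 2 ≠ 0 := by simpa using hη
  obtain ⟨g, hg, -⟩ := (memLp_one_iff_integrable.2 hu).exists_boundedContinuous_eLpNorm_sub_le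
    ENNReal.one_ne_top hη2
  have hd : g.toContinuousMap ∈ closure
      (Submodule.span ℂ (Set.range (@fourier T)) : Set C(AddCircle T, ℂ)) := by
    have := (span_fourier_closure_eq_top (T := T)).ge (Submodule.mem_top (x := g.toContinuousMap))
    exact this
  obtain ⟨e, he0, he⟩ := ENNReal.lt_iff_exists_nnreal_btwn.1 (pos_iff_ne_zero.2 hη2)
  obtain ⟨p, hp, hgp⟩ := Metric.mem_closure_iff.1 hd e (by exact_mod_cast he0)
  refine ⟨p, hp, ?_⟩
  have hb : eLpNorm (⇑g - ⇑p) 1 haarAddCircle ≤ η / 2 := by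
    refine (eLpNorm_le_of_ae_enorm_bound (C := (e : ℝ≥0∞)) (ae_of_all _ fun x => ?_)).trans ?_
    · have h1 : dist (g x) (p x) ≤ e := (ContinuousMap.dist_apply_le_dist
        (f := g.toContinuousMap) (g := p) x).trans hgp.le
      rw [Pi.sub_apply, ← edist_eq_enorm_sub, edist_dist]
      exact ENNReal.ofReal_le_of_le_toReal (by simpa using h1)
    · simpa using he.le
  calc eLpNorm (u - ⇑p) 1 haarAddCircle = eLpNorm ((u - ⇑g) + (⇑g - ⇑p)) 1 haarAddCircle := by
        rw [sub_add_sub_cancel]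
    _ ≤ η / 2 + η / 2 := (eLpNorm_add_le (hu.aestronglyMeasurable.sub
        g.continuous.aestronglyMeasurable) (g.continuous.sub p.continuous).aestronglyMeasurable
        le_rfl).trans (add_le_add hg hb)
    _ = η := ENNReal.add_halves η

/-- Poisson integrals converge in `L¹`. -/
theorem tendsto_eLpNorm_poissonMean_sub {u : AddCircle T → ℂ} (hu : Integrable u haarAddCircle) :
    Tendsto (fun r => eLpNorm (poissonMean r u - u) 1 haarAddCircle) (𝓝[Set.Ico 0 1] 1)
      (𝓝 0) := by
  rw [ENNReal.tendsto_nhds_zero]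
  intro η hη
  have h3 : η / 3 ≠ 0 := by simpa using hη.ne'
  obtain ⟨p, hp, hup⟩ := exists_mem_span_fourier_eLpNorm_sub_le hu h3
  have hpi : Integrable p haarAddCircle := integrable_of_continuous p.continuous
  filter_upwards [self_mem_nhdsWithin, ENNReal.tendsto_nhds_zero.1
    (tendsto_eLpNorm_poissonMean_sub_of_mem_span hp) _ (pos_iff_ne_zero.2 h3)] with r hr hrp
  have m1 := (continuous_poissonMean hr.1 hr.2 (hu.sub hpi)).aestronglyMeasurable
    (μ := haarAddCircle)
  have m2 := ((continuous_poissonMean hr.1 hr.2 hpi).sub p.continuous).aestronglyMeasurable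
    (μ := haarAddCircle)
  have m3 := (p.continuous.aestronglyMeasurable (μ := haarAddCircle)).sub hu.aestronglyMeasurable
  calc eLpNorm (poissonMean r u - u) 1 haarAddCircle
      = eLpNorm (poissonMean r (u - ⇑p) + (poissonMean r p - ⇑p) + (⇑p - u)) 1 haarAddCircle := by
        rw [poissonMean_sub hr.1 hr.2 hu hpi]
        congr 1; abel
    _ ≤ η / 3 + η / 3 + η / 3 := by
        refine (eLpNorm_add_le (m1.add m2) m3 le_rfl).trans (add_le_add
          ((eLpNorm_add_le m1 m2 le_rfl).trans (add_le_add ?_ hrp)) ?_)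
        · exact (eLpNorm_poissonMean_le hr.1 hr.2 (hu.sub hpi)).trans hup
        · rwa [eLpNorm_sub_comm]
    _ = η := ENNReal.add_thirds η

end PoissonMeans

/-! ### Boundary factorization of a density by its Wold coefficients. -/

section WoldFactorization

open AddCircle

theorem fact_two_pi_pos : Fact (0 < 2 * Real.pi) := ⟨by positivity⟩

attribute [local instance] fact_two_pi_pos

/-- The function `log g` on the circle. -/
def logCircle (g : ℝ → ℝ) : AddCircle (2 * Real.pi) → ℂ :=
  AddCircle.liftIoc (2 * Real.pi) (-Real.pi) fun l => (Real.log (g l) : ℂ)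

variable {g : ℝ → ℝ}

theorem integrable_logCircle (hlog : LogIntegrable g) :
    Integrable (logCircle g) haarAddCircle := by
  rw [← memLp_one_iff_integrable]
  refine MemLp.haarAddCircle (MemLp.memLp_liftIoc ?_)
  rw [memLp_one_iff_integrable, show -Real.pi + 2 * Real.pi = Real.pi by ring]
  exact hlog.2.ofReal

theorem fourier_two_pi (k : ℤ) (x : ℝ) :
    fourier k (x : AddCircle (2 * Real.pi)) = Complex.exp (Complex.I * k * x) := by
  rw [fourier_coe_apply]
  congr 1
  have : (Real.pi : ℂ) ≠ 0 := by exact_mod_cast Real.pi_ne_zero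
  push_cast
  field_simp

theorem fourierCoeff_logCircle (g : ℝ → ℝ) (k : ℤ) :
    fourierCoeff (logCircle g) k = (2 * Real.pi : ℂ)⁻¹ *
      ∫ l in (-Real.pi)..Real.pi, (Real.log (g l) : ℂ) * Complex.exp (-(Complex.I * k * l)) := by
  rw [fourierCoeff_eq_intervalIntegral _ _ (-Real.pi),
    show -Real.pi + 2 * Real.pi = Real.pi by ring, Complex.real_smul, one_div]
  push_cast
  congr 1
  refine intervalIntegral.integral_congr_ae (ae_of_all _ fun l hl => ?_)
  rw [Set.uIoc_of_le (by linarith [Real.pi_pos])] at hl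
  rw [logCircle, AddCircle.liftIoc_coe_apply (by
    rwa [show -Real.pi + 2 * Real.pi = Real.pi by ring]), fourier_two_pi, smul_eq_mul, mul_comm]
  congr 2
  push_cast
  ring

theorem fourierCoeff_logCircle_neg (hcand : IsSpectralCandidate g) (k : ℤ) :
    fourierCoeff (logCircle g) (-k) = fourierCoeff (logCircle g) k := by
  rw [fourierCoeff_logCircle, fourierCoeff_logCircle]
  congr 1
  conv_lhs => rw [← neg_neg Real.pi]
  rw [← intervalIntegral.integral_comp_neg]
  rw [neg_neg]
  refine intervalIntegral.integral_congr fun l hl => ?_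
  rw [Set.uIcc_of_le (by linarith [Real.pi_pos])] at hl
  rw [(hcand l hl).2]
  congr 2
  push_cast
  ring

/-- As `log g` is real and even, the coefficient equals its conjugate, so the real part in
`logFourierCoeff` loses nothing. -/
theorem fourierCoeff_logCircle_natCast (hcand : IsSpectralCandidate g) (k : ℕ) :
    fourierCoeff (logCircle g) k = logFourierCoeff g k := by
  have hre : (fourierCoeff (logCircle g) k).re = logFourierCoeff g k := by
    rw [fourierCoeff_logCircle, logFourierCoeff]
    norm_cast
  have hconj : (starRingEnd ℂ) (fourierCoeff (logCircle g) k) = fourierCoeff (logCircle g) k := by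
    conv_rhs => rw [← fourierCoeff_logCircle_neg hcand]
    rw [fourierCoeff_logCircle, fourierCoeff_logCircle, map_mul]
    congr 1
    · simp [map_ofNat]
    · rw [intervalIntegral.integral_of_le (by linarith [Real.pi_pos]),
        intervalIntegral.integral_of_le (by linarith [Real.pi_pos]), ← integral_conj]
      refine integral_congr_ae (ae_of_all _ fun l => ?_)
      simp only [map_mul, Complex.conj_ofReal, ← Complex.exp_conj]
      congr 2
      simp
  rw [← hre, Complex.conj_eq_iff_re.1 hconj]

theorem abs_logFourierCoeff_le (hcand : IsSpectralCandidate g) (hlog : LogIntegrable g) (k : ℕ) :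
    |logFourierCoeff g k| ≤ ∫ x, ‖logCircle g x‖ ∂haarAddCircle := by
  rw [← Real.norm_eq_abs, ← Complex.norm_real, ← fourierCoeff_logCircle_natCast hcand, fourierCoeff]
  refine norm_integral_le_of_norm_le (integrable_logCircle hlog).norm (ae_of_all _ fun x => ?_)
  rw [norm_smul, norm_fourier_apply, one_mul]

/-- The Poisson means of `log g` are the logarithms of the squared modulus of the outer function
with Taylor coefficients `c_k`. -/
theorem exp_re_poissonMean_logCircle (hcand : IsSpectralCandidate g) (hlog : LogIntegrable g)
    (hs : Summable fun k => |woldCoeff g k|) {r : ℝ} (h0 : 0 ≤ r) (h1 : r < 1) (x : ℝ) :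
    Real.exp (poissonMean r (logCircle g) x).re = Real.exp (logFourierCoeff g 0) *
      ‖∑' k, (woldCoeff g k : ℂ) * (r * Complex.exp (Complex.I * x)) ^ k‖ ^ 2 := by
  set z : ℂ := r * Complex.exp (Complex.I * x) with hz
  set a := logFourierCoeff g
  have hzn : ‖z‖ < 1 := by
    rw [hz, norm_mul, mul_comm Complex.I, Complex.norm_exp_ofReal_mul_I, mul_one,
      Complex.norm_real, Real.norm_eq_abs, abs_of_nonneg h0]
    exact h1
  have hpow : ∀ k : ℕ, (r : ℂ) ^ k * fourier (k : ℤ) (x : AddCircle (2 * Real.pi)) = z ^ k :=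
    fun k => by
      rw [fourier_two_pi, hz, mul_pow, ← Complex.exp_nat_mul]
      congr 2
      push_cast
      ring
  set S : ℂ := ∑' k : ℕ, (a (k + 1) : ℂ) * z ^ (k + 1)
  have hsumS : HasSum (fun k : ℕ => (a (k + 1) : ℂ) * z ^ (k + 1)) S := by
    have hb : ∀ k, ‖(a k : ℂ)‖ ≤ ∫ x, ‖logCircle g x‖ ∂haarAddCircle := fun k => by
      rw [Complex.norm_real]
      exact abs_logFourierCoeff_le hcand hlog k
    exact ((summable_nat_add_iff 1).2 (summable_norm_mul_pow hb hzn).of_norm).hasSum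
  -- The positive frequencies give `S` and the negative ones its conjugate. The real part `a 0 + 2
  -- Re S` is thus the logarithm of `exp(a 0) |exp S|²`.
  have hA : poissonMean r (logCircle g) x = a 0 + S + (starRingEnd ℂ) S := by
    have hP := hasSum_poissonMean h0 h1 (integrable_logCircle hlog) (x : AddCircle (2 * Real.pi))
    refine hP.unique ?_
    have e1 : ∀ k : ℕ, (r : ℂ) ^ (k : ℤ).natAbs * fourierCoeff (logCircle g) (k : ℤ) *
        fourier (k : ℤ) (x : AddCircle (2 * Real.pi)) = a k * z ^ k := fun k => by
      rw [Int.natAbs_natCast, fourierCoeff_logCircle_natCast hcand, mul_right_comm, hpow, mul_comm]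
    have e2 : ∀ k : ℕ, (r : ℂ) ^ (-((k : ℤ) + 1)).natAbs *
        fourierCoeff (logCircle g) (-((k : ℤ) + 1)) *
        fourier (-((k : ℤ) + 1)) (x : AddCircle (2 * Real.pi)) =
          (starRingEnd ℂ) (a (k + 1) * z ^ (k + 1)) := fun k => by
      rw [Int.natAbs_neg, fourierCoeff_logCircle_neg hcand, fourier_neg, ← Nat.cast_succ,
        Int.natAbs_natCast, fourierCoeff_logCircle_natCast hcand, map_mul,
        Complex.conj_ofReal, ← hpow (k + 1), map_mul, map_pow, Complex.conj_ofReal]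
      simp only [a, Nat.succ_eq_add_one]
      ring
    refine HasSum.of_nat_of_neg_add_one ?_ ?_
    · simp_rw [e1]
      have := HasSum.zero_add (f := fun k : ℕ => (a k : ℂ) * z ^ k) hsumS
      rwa [pow_zero, mul_one] at this
    · simp_rw [e2]
      exact hsumS.map (starRingEnd ℂ) Complex.continuous_conj
  have hw : ∑' k, (woldCoeff g k : ℂ) * z ^ k = Complex.exp S :=
    tsum_woldRec_mul_pow (fun k => abs_logFourierCoeff_le hcand hlog k)
      (fun k => hs.le_tsum k fun _ _ => abs_nonneg _) hzn
  rw [hw, hA, Complex.norm_exp, ← Real.exp_nat_mul, ← Real.exp_add]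
  congr 1
  simp
  ring

/-- The spectral density is recovered almost everywhere from its Wold coefficients. -/
theorem ae_eq_innovVar_mul_norm_sq (hcand : IsSpectralCandidate g) (hlog : LogIntegrable g)
    (hs : Summable fun k => |woldCoeff g k|) :
    ∀ᵐ x ∂volume.restrict (Set.Ioc (-Real.pi) Real.pi), g x = innovVar g / (2 * Real.pi) *
      ‖∑' k, (woldCoeff g k : ℂ) * Complex.exp (Complex.I * x) ^ k‖ ^ 2 := by
  have hint := integrable_logCircle hlog
  let r : ℕ → ℝ := fun n => 1 - 1 / ((n : ℝ) + 1)
  have hr0 : ∀ n, 0 ≤ r n := fun n => by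
    have : 1 / ((n : ℝ) + 1) ≤ 1 := by
      rw [div_le_one (by positivity)]; linarith [(Nat.cast_nonneg n : (0 : ℝ) ≤ n)]
    simp only [r]; linarith
  have hr1 : ∀ n, r n < 1 := fun n => by
    have : 0 < 1 / ((n : ℝ) + 1) := by positivity
    simp only [r]; linarith
  have hr : Tendsto r atTop (𝓝 1) := by
    have := (tendsto_one_div_add_atTop_nhds_zero_nat (𝕜 := ℝ)).const_sub 1
    rwa [sub_zero] at this
  have hrw : Tendsto r atTop (𝓝[Set.Ico 0 1] 1) :=
    tendsto_nhdsWithin_iff.2 ⟨hr, Eventually.of_forall fun n => ⟨hr0 n, hr1 n⟩⟩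
  -- Convergence in `L¹` implies convergence almost everywhere along a subsequence of radii, which
  -- suffices to identify the limit.
  obtain ⟨ns, hns, hae⟩ := (tendstoInMeasure_of_tendsto_eLpNorm one_ne_zero
    (fun n => (continuous_poissonMean (hr0 n) (hr1 n) hint).aestronglyMeasurable)
    hint.aestronglyMeasurable ((tendsto_eLpNorm_poissonMean_sub hint).comp hrw)
    ).exists_seq_tendsto_ae
  have hae' : ∀ᵐ y ∂(volume : Measure (AddCircle (2 * Real.pi))),
      Tendsto (fun i => poissonMean (r (ns i)) (logCircle g) y) atTop (𝓝 (logCircle g y)) := by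
    rw [volume_eq_smul_haarAddCircle]
    exact Measure.ae_smul_measure hae _
  have hmp := AddCircle.measurePreserving_mk (2 * Real.pi) (-Real.pi)
  rw [show -Real.pi + 2 * Real.pi = Real.pi by ring] at hmp
  filter_upwards [hmp.quasiMeasurePreserving.ae hae', hlog.1,
    ae_restrict_mem measurableSet_Ioc] with x hx hpos hmem
  have hlx : logCircle g x = (Real.log (g x) : ℂ) := by
    rw [logCircle, AddCircle.liftIoc_coe_apply (by
      rwa [show -Real.pi + 2 * Real.pi = Real.pi by ring])]
  rw [hlx] at hx
  -- Positivity of `g x` matters here: `Real.log 0 = 0`, so `exp (log g)` returns `g` only where `g`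
  -- is positive.
  have hlim1 := (Real.continuous_exp.tendsto _).comp ((Complex.continuous_re.tendsto _).comp hx)
  rw [Complex.ofReal_re, Real.exp_log hpos] at hlim1
  -- Absolute summability of the Wold coefficients gives the radial limit at every boundary point,
  -- by dominated convergence for series.
  have hlim2 : Tendsto (fun i => ∑' k, (woldCoeff g k : ℂ) *
      (r (ns i) * Complex.exp (Complex.I * x)) ^ k) atTop
      (𝓝 (∑' k, (woldCoeff g k : ℂ) * Complex.exp (Complex.I * x) ^ k)) := by
    refine tendsto_tsum_of_dominated_convergence hs (fun k => ?_)
      (Eventually.of_forall fun i k => ?_)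
    · have hc : Tendsto (fun i => (r (ns i) : ℂ)) atTop (𝓝 ((1 : ℝ) : ℂ)) :=
        (Complex.continuous_ofReal.tendsto _).comp (hr.comp hns.tendsto_atTop)
      simpa using ((hc.mul_const (Complex.exp (Complex.I * x))).pow k).const_mul
        (woldCoeff g k : ℂ)
    · rw [norm_mul, norm_pow, norm_mul, mul_comm Complex.I, Complex.norm_exp_ofReal_mul_I, mul_one,
        Complex.norm_real, Complex.norm_real, Real.norm_eq_abs, Real.norm_eq_abs,
        abs_of_nonneg (hr0 _)]
      exact mul_le_of_le_one_right (abs_nonneg _) (pow_le_one₀ (hr0 _) (hr1 _).le)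
  have hlim3 := ((hlim2.norm.pow 2).const_mul (Real.exp (logFourierCoeff g 0)))
  refine (tendsto_nhds_unique hlim1 (hlim3.congr fun i => ?_)).trans ?_
  · exact (exp_re_poissonMean_logCircle hcand hlog hs (hr0 _) (hr1 _) x).symm
  · rw [innovVar]
    field_simp

end WoldFactorization

/-! ### Parseval and Dirichlet-sum identities on `(-π, π]`. -/

section FourierIdentities

/-- The exponential `e^{ikl}`. -/
def expI (k : ℤ) (l : ℝ) : ℂ := Complex.exp (Complex.I * k * l)

/-- Lebesgue measure on `(-π, π]`. -/
def circleVolume : Measure ℝ := volume.restrict (Set.Ioc (-Real.pi) Real.pi)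

instance : IsFiniteMeasure circleVolume := by rw [circleVolume]; infer_instance

theorem continuous_expI (k : ℤ) : Continuous (expI k) := by unfold expI; fun_prop

theorem norm_expI (k : ℤ) (l : ℝ) : ‖expI k l‖ = 1 := by
  have : Complex.I * k * l = ((k * l : ℝ) : ℂ) * Complex.I := by push_cast; ring
  rw [expI, this, Complex.norm_exp_ofReal_mul_I]

theorem expI_add (j k : ℤ) (l : ℝ) : expI (j + k) l = expI j l * expI k l := by
  rw [expI, expI, expI, ← Complex.exp_add]; congr 1; push_cast; ring

theorem conj_expI (k : ℤ) (l : ℝ) : (starRingEnd ℂ) (expI k l) = expI (-k) l := by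
  rw [expI, expI, ← Complex.exp_conj]; congr 1; simp

theorem integrable_of_norm_le {F : ℝ → ℂ} (hF : Continuous F) {M : ℝ} (hM : ∀ l, ‖F l‖ ≤ M) :
    Integrable F circleVolume :=
  Integrable.of_bound hF.aestronglyMeasurable M (ae_of_all _ hM)

theorem integral_expI (k : ℤ) :
    ∫ l, expI k l ∂circleVolume = if k = 0 then (2 * Real.pi : ℂ) else 0 := by
  rw [circleVolume, ← intervalIntegral.integral_of_le (by linarith [Real.pi_pos])]
  split_ifs with h
  · subst h
    simp [expI]
    ring
  · unfold expI
    have hk : Complex.I * k ≠ 0 := mul_ne_zero Complex.I_ne_zero (by exact_mod_cast h)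
    rw [integral_exp_mul_complex hk]
    have : Complex.exp (Complex.I * k * (Real.pi : ℝ)) =
        Complex.exp (Complex.I * k * (-Real.pi : ℝ)) := by
      rw [Complex.exp_eq_exp_iff_exists_int]
      exact ⟨k, by push_cast; ring⟩
    rw [this, sub_self, zero_div]

variable {β : ℤ → ℝ}

theorem norm_mul_expI (k j : ℤ) (l : ℝ) : ‖(β k : ℂ) * expI j l‖ = |β k| := by
  rw [norm_mul, norm_expI, mul_one, Complex.norm_real, Real.norm_eq_abs]

/-- The Fourier series with coefficients `β`. -/
def fourierSeries (β : ℤ → ℝ) (l : ℝ) : ℂ := ∑' k, (β k : ℂ) * expI (-k) l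

theorem hasSum_fourierSeries (hβ : Summable fun k => |β k|) (l : ℝ) :
    HasSum (fun k => (β k : ℂ) * expI (-k) l) (fourierSeries β l) := by
  refine (Summable.of_norm ?_).hasSum
  simp_rw [norm_mul_expI]
  exact hβ

theorem continuous_fourierSeries (hβ : Summable fun k => |β k|) : Continuous (fourierSeries β) :=
  continuous_tsum (fun _ => continuous_const.mul (continuous_expI _)) hβ
    fun _ l => (norm_mul_expI _ _ l).le

theorem norm_fourierSeries_le (hβ : Summable fun k => |β k|) (l : ℝ) :
    ‖fourierSeries β l‖ ≤ ∑' k, |β k| := by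
  refine (norm_tsum_le_tsum_norm ?_).trans (le_of_eq ?_) <;> simp_rw [norm_mul_expI]
  exact hβ

theorem integral_fourierSeries_mul_expI (hβ : Summable fun k => |β k|) (h : ℤ) :
    ∫ l, fourierSeries β l * expI h l ∂circleVolume = 2 * Real.pi * β h := by
  have hF : ∀ (k : ℤ) l, (β k : ℂ) * expI (-k) l * expI h l = β k * expI (h - k) l := fun k l => by
    rw [mul_assoc, ← expI_add, neg_add_eq_sub]
  have hs := hasSum_integral_of_summable_integral_norm (μ := circleVolume)
    (F := fun (k : ℤ) l => (β k : ℂ) * expI (-k) l * expI h l)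
    (fun k => by
      simp_rw [hF]
      exact (integrable_of_norm_le (continuous_expI _) fun l => (norm_expI _ l).le).const_mul _)
    (by
      simp_rw [hF, norm_mul_expI, integral_const, smul_eq_mul]
      exact hβ.mul_left _)
  simp_rw [tsum_mul_right] at hs
  refine hs.unique ?_
  simp_rw [hF, integral_const_mul, integral_expI]
  have e : ∀ k, (β k : ℂ) * (if h - k = 0 then (2 * Real.pi : ℂ) else 0) =
      if k = h then (2 * Real.pi * β h : ℂ) else 0 := fun k => by
    by_cases hk : k = h
    · subst hk; simp; ring
    · have : h - k ≠ 0 := sub_ne_zero.2 (Ne.symm hk)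
      simp [hk, this]
  simp_rw [e]
  exact hasSum_ite_eq h _

/-- Parseval's identity for absolutely convergent Fourier series. -/
theorem integral_norm_sq_fourierSeries (hβ : Summable fun k => |β k|) :
    ∫ l, ‖fourierSeries β l‖ ^ 2 ∂circleVolume = 2 * Real.pi * ∑' k, β k ^ 2 := by
  have hF : ∀ (k : ℤ) l, fourierSeries β l * ((β k : ℂ) * expI k l) =
      β k * (fourierSeries β l * expI k l) := fun k l => by ring
  have hi : ∀ k, Integrable (fun l => fourierSeries β l * expI k l) circleVolume := fun k =>
    integrable_of_norm_le ((continuous_fourierSeries hβ).mul (continuous_expI k)) fun l => by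
      rw [norm_mul, norm_expI, mul_one]; exact norm_fourierSeries_le hβ l
  have hs := hasSum_integral_of_summable_integral_norm (μ := circleVolume)
    (F := fun (k : ℤ) l => fourierSeries β l * ((β k : ℂ) * expI k l))
    (fun k => by simp_rw [hF]; exact (hi k).const_mul _)
    (by
      simp_rw [norm_mul _ ((β _ : ℂ) * _), norm_mul_expI, integral_mul_const]
      exact hβ.mul_left _)
  have he : ∀ l, ∑' k, fourierSeries β l * ((β k : ℂ) * expI k l) =
      ((‖fourierSeries β l‖ ^ 2 : ℝ) : ℂ) := fun l => by
    have := (hasSum_fourierSeries hβ l).map (starRingEnd ℂ) Complex.continuous_conj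
    rw [tsum_mul_left, ← Complex.normSq_eq_norm_sq, ← Complex.mul_conj, ← this.tsum_eq]
    simp [conj_expI]
  simp_rw [he, hF, integral_const_mul, integral_fourierSeries_mul_expI hβ] at hs
  rw [integral_complex_ofReal] at hs
  have hs2 : HasSum (fun k => ((2 * Real.pi * β k ^ 2 : ℝ) : ℂ))
      ((∫ l, ‖fourierSeries β l‖ ^ 2 ∂circleVolume : ℝ) : ℂ) := by
    have e : ∀ k, ((2 * Real.pi * β k ^ 2 : ℝ) : ℂ) = β k * (2 * Real.pi * β k) := fun k => by
      push_cast; ring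
    simp_rw [e]
    exact hs
  rw [← tsum_mul_left, (Complex.hasSum_ofReal.1 hs2).tsum_eq]

/-- The Dirichlet-type sum `∑_{t=1}^n e^{-itl}`. -/
def dirichletSum (n : ℕ) (l : ℝ) : ℂ := ∑ i : Fin n, expI (-((i : ℤ) + 1)) l

theorem continuous_dirichletSum (n : ℕ) : Continuous (dirichletSum n) :=
  continuous_finsetSum _ fun _ _ => continuous_expI _

theorem normSq_dirichletSum (n : ℕ) (l : ℝ) :
    ((‖dirichletSum n l‖ ^ 2 : ℝ) : ℂ) = ∑ i : Fin n, ∑ j : Fin n, expI ((j : ℤ) - i) l := by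
  rw [← Complex.normSq_eq_norm_sq, ← Complex.mul_conj, dirichletSum, map_sum, Finset.sum_mul_sum]
  refine Finset.sum_congr rfl fun i _ => Finset.sum_congr rfl fun j _ => ?_
  rw [conj_expI, ← expI_add]
  congr 1
  ring

/-- The square `|D_n|²` is the sum of the exponentials of frequency `j - i`, each of which picks out
one coefficient. For autocovariances the double sum is the variance of a sum of `n` terms. -/
theorem integral_re_fourierSeries_mul (hβ : Summable fun k => |β k|) (n : ℕ) :
    ∫ l, (fourierSeries β l).re * ‖dirichletSum n l‖ ^ 2 ∂circleVolume =
      2 * Real.pi * ∑ i : Fin n, ∑ j : Fin n, β ((j : ℤ) - i) := by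
  have hi : ∀ k, Integrable (fun l => fourierSeries β l * expI k l) circleVolume := fun k =>
    integrable_of_norm_le ((continuous_fourierSeries hβ).mul (continuous_expI k)) fun l => by
      rw [norm_mul, norm_expI, mul_one]; exact norm_fourierSeries_le hβ l
  have he : ∀ l, fourierSeries β l * ((‖dirichletSum n l‖ ^ 2 : ℝ) : ℂ) =
      ∑ i : Fin n, ∑ j : Fin n, fourierSeries β l * expI ((j : ℤ) - i) l := fun l => by
    rw [normSq_dirichletSum, Finset.mul_sum]
    exact Finset.sum_congr rfl fun i _ => Finset.mul_sum _ _ _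
  have hI : Integrable (fun l => fourierSeries β l * ((‖dirichletSum n l‖ ^ 2 : ℝ) : ℂ))
      circleVolume := by
    simp_rw [he]
    exact integrable_finsetSum _ fun i _ => integrable_finsetSum _ fun j _ => hi _
  have hre : ∀ l, (fourierSeries β l).re * ‖dirichletSum n l‖ ^ 2 =
      (fourierSeries β l * ((‖dirichletSum n l‖ ^ 2 : ℝ) : ℂ)).re := fun l =>
    (Complex.re_mul_ofReal _ _).symm
  have := integral_re hI
  simp only [RCLike.re_to_complex] at this
  simp_rw [hre]
  rw [this]
  simp_rw [he]
  rw [integral_finsetSum _ fun i _ => integrable_finsetSum _ fun j _ => hi _]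
  have h2 : ∀ i : Fin n, ∫ l, ∑ j : Fin n, fourierSeries β l * expI ((j : ℤ) - i) l ∂circleVolume =
      ((2 * Real.pi * ∑ j : Fin n, β ((j : ℤ) - i) : ℝ) : ℂ) := fun i => by
    rw [integral_finsetSum _ fun j _ => hi _]
    simp_rw [integral_fourierSeries_mul_expI hβ]
    rw [Finset.mul_sum]
    push_cast
    rfl
  simp_rw [h2]
  rw [← Complex.ofReal_sum, Complex.ofReal_re, Finset.mul_sum]

/-- The preceding identity for the unit sequence at `0`, whose Fourier series is constantly one. -/
theorem integral_norm_sq_dirichletSum (n : ℕ) :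
    ∫ l, ‖dirichletSum n l‖ ^ 2 ∂circleVolume = 2 * Real.pi * n := by
  have hs : Summable fun k : ℤ => |(Pi.single 0 1 : ℤ → ℝ) k| :=
    summable_of_ne_finset_zero (s := {0}) fun k hk => by
      rw [Pi.single_eq_of_ne (by simpa using hk), abs_zero]
  have h := integral_re_fourierSeries_mul hs n
  have h1 : ∀ l, fourierSeries (Pi.single 0 1) l = 1 := fun l => by
    rw [fourierSeries, tsum_eq_single 0]
    · simp [expI]
    · intro k hk; rw [Pi.single_eq_of_ne hk]; simp
  have h2 : ∀ i j : Fin n, (Pi.single 0 1 : ℤ → ℝ) ((j : ℤ) - i) = if j = i then 1 else 0 := by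
    intro i j
    rw [Pi.single_apply]
    refine if_congr ?_ rfl rfl
    rw [sub_eq_zero, Nat.cast_inj, Fin.val_inj]
  simpa [h1, h2] using h

end FourierIdentities

/-! ### Cesàro convergence of double sums of autocovariances. -/

section Cesaro

/-- Enlarging the square adds one row and one column, that is, the lags `-n, …, n`; the term `γ 0`
is subtracted because the range counts it twice. -/
theorem sum_fin_sum_fin_succ (γ : ℤ → ℝ) (n : ℕ) :
    ∑ i : Fin (n + 1), ∑ j : Fin (n + 1), γ ((j : ℤ) - i) =
      ∑ i : Fin n, ∑ j : Fin n, γ ((j : ℤ) - i) +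
        (∑ k ∈ Finset.range (n + 1), (γ k + γ (-k)) - γ 0) := by
  have h : ∀ m : ℕ, ∑ i : Fin m, ∑ j : Fin m, γ ((j : ℤ) - i) =
      ∑ i ∈ Finset.range m, ∑ j ∈ Finset.range m, γ ((j : ℤ) - i) := fun m => by
    rw [Finset.sum_range]
    exact Finset.sum_congr rfl fun i _ => (Finset.sum_range fun j => γ ((j : ℤ) - i)).symm
  have hr : ∀ f : ℤ → ℝ, ∑ i ∈ Finset.range n, f ((n : ℤ) - i) =
      ∑ k ∈ Finset.range n, f ((k : ℤ) + 1) := fun f => by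
    rw [← Finset.sum_range_reflect]
    refine Finset.sum_congr rfl fun k hk => ?_
    have := Finset.mem_range.1 hk
    congr 1
    omega
  rw [h, h, Finset.sum_range_succ]
  simp_rw [Finset.sum_range_succ _ n, Finset.sum_add_distrib]
  have h1 := hr γ
  have h2 := hr fun k => γ (-k)
  simp only [neg_sub] at h2
  rw [h1, h2, sub_self]
  have h3 : ∑ k ∈ Finset.range n, γ ((k : ℤ) + 1) + γ 0 = ∑ k ∈ Finset.range n, γ k + γ n := by
    have := Finset.sum_range_succ' (fun k : ℕ => γ k) n
    rw [Finset.sum_range_succ] at this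
    simpa using this.symm
  have h4 : ∑ k ∈ Finset.range n, γ (-((k : ℤ) + 1)) + γ 0 =
      ∑ k ∈ Finset.range n, γ (-k) + γ (-n) := by
    have := Finset.sum_range_succ' (fun k : ℕ => γ (-k)) n
    rw [Finset.sum_range_succ] at this
    simpa using this.symm
  linarith

/-- The normalized double sums of a summable sequence converge to its sum. -/
theorem tendsto_sum_sum_div {γ : ℤ → ℝ} (hγ : Summable γ) :
    Tendsto (fun n : ℕ => (∑ i : Fin n, ∑ j : Fin n, γ ((j : ℤ) - i)) / n) atTop
      (𝓝 (∑' h, γ h)) := by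
  let u : ℕ → ℝ := fun n => ∑ k ∈ Finset.range (n + 1), (γ k + γ (-k)) - γ 0
  have hu : Tendsto u atTop (𝓝 (∑' h, γ h)) := by
    have := ((hγ.hasSum.nat_add_neg.tendsto_sum_nat).comp (tendsto_add_atTop_nat 1)).sub_const (γ 0)
    rwa [add_sub_cancel_right] at this
  have hT : ∀ n : ℕ, ∑ i : Fin n, ∑ j : Fin n, γ ((j : ℤ) - i) = ∑ m ∈ Finset.range n, u m := by
    intro n
    induction n with
    | zero => simp
    | succ n ih => rw [sum_fin_sum_fin_succ, ih, Finset.sum_range_succ u]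
  refine hu.cesaro.congr fun n => ?_
  rw [hT, div_eq_inv_mul]

end Cesaro

/-! ### Weights of the innovations and the variance of the bootstrap sum. -/

section LinearWeights

/-- Extension by zero to the integers of a sequence indexed by the natural numbers. -/
def intExtend (c : ℕ → ℝ) : ℤ → ℝ := Function.extend (Nat.cast : ℕ → ℤ) c 0

/-- The coefficient of the innovation `ε_k` in `∑_{t=1}^n ∑_{j ≥ 0} c_j ε_{t-j}`. -/
def sumWeight (c : ℕ → ℝ) (n : ℕ) (k : ℤ) : ℝ := ∑ i : Fin n, intExtend c ((i : ℤ) + 1 - k)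

variable {c : ℕ → ℝ}

theorem intExtend_natCast (c : ℕ → ℝ) (k : ℕ) : intExtend c k = c k :=
  Nat.cast_injective.extend_apply c 0 k

theorem intExtend_of_notMem {m : ℤ} (hm : m ∉ Set.range (Nat.cast : ℕ → ℤ)) :
    intExtend c m = 0 :=
  Function.extend_apply' _ _ _ hm

theorem summable_abs_intExtend (hc : Summable fun k => |c k|) :
    Summable fun m => |intExtend c m| := by
  refine (Nat.cast_injective.summable_iff (f := fun m => |intExtend c m|) (fun m hm => ?_)).1 ?_
  · rw [intExtend_of_notMem hm, abs_zero]
  · simpa [Function.comp_def, intExtend_natCast] using hc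

theorem tsum_abs_intExtend (c : ℕ → ℝ) : ∑' m, |intExtend c m| = ∑' k, |c k| := by
  rw [← Nat.cast_injective.tsum_eq (f := fun m => |intExtend c m|)]
  · simp [intExtend_natCast]
  · intro m hm
    by_contra h
    exact hm (by simp [intExtend_of_notMem h])

theorem tsum_intExtend_mul {E : Type*} [NormedAddCommGroup E] [NormedSpace ℝ E] (c : ℕ → ℝ)
    (y : ℤ → E) : ∑' m, intExtend c m • y m = ∑' k : ℕ, c k • y k := by
  rw [← Nat.cast_injective.tsum_eq (f := fun m => intExtend c m • y m)]
  · simp [intExtend_natCast]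
  · intro m hm
    by_contra h
    exact hm (by simp [intExtend_of_notMem h])

theorem summable_abs_intExtend_sub (hc : Summable fun k => |c k|) (t : ℤ) :
    Summable fun k => |intExtend c (t - k)| :=
  (Equiv.subLeft t).summable_iff.2 (summable_abs_intExtend hc)

theorem tsum_abs_intExtend_sub (c : ℕ → ℝ) (t : ℤ) :
    ∑' k, |intExtend c (t - k)| = ∑' k, |c k| := by
  rw [← tsum_abs_intExtend]
  exact (Equiv.subLeft t).tsum_eq fun m => |intExtend c m|

theorem tsum_intExtend_sub_smul {E : Type*} [NormedAddCommGroup E] [NormedSpace ℝ E] (c : ℕ → ℝ)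
    (y : ℤ → E) (t : ℤ) :
    ∑' k, intExtend c (t - k) • y k = ∑' j : ℕ, c j • y (t - j) := by
  rw [← tsum_intExtend_mul c fun m => y (t - m), ← (Equiv.subLeft t).tsum_eq]
  simp

theorem summable_abs_sumWeight (hc : Summable fun k => |c k|) (n : ℕ) :
    Summable fun k => |sumWeight c n k| :=
  Summable.of_nonneg_of_le (fun _ => abs_nonneg _) (fun _ => Finset.abs_sum_le_sum_abs _ _)
    (summable_sum fun i _ => summable_abs_intExtend_sub hc ((i : ℤ) + 1))

theorem tsum_abs_sumWeight_le (hc : Summable fun k => |c k|) (n : ℕ) :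
    ∑' k, |sumWeight c n k| ≤ n * ∑' k, |c k| := by
  have hs : ∀ i : Fin n, Summable fun k => |intExtend c ((i : ℤ) + 1 - k)| := fun i =>
    summable_abs_intExtend_sub hc _
  calc ∑' k, |sumWeight c n k| ≤ ∑' k, ∑ i : Fin n, |intExtend c ((i : ℤ) + 1 - k)| :=
        (summable_abs_sumWeight hc n).tsum_le_tsum (fun _ => Finset.abs_sum_le_sum_abs _ _)
          (summable_sum fun i _ => hs i)
    _ = n * ∑' k, |c k| := by
        rw [Summable.tsum_finsetSum fun i _ => hs i]
        simp_rw [tsum_abs_intExtend_sub]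
        simp

/-- For fixed `k` the indices `i + 1 - k` are distinct, so the weight is a sum over part of the
coefficients. The bound is free of `n`; dividing by `√n` makes the weights uniformly small. -/
theorem abs_sumWeight_le (hc : Summable fun k => |c k|) (n : ℕ) (k : ℤ) :
    |sumWeight c n k| ≤ ∑' k, |c k| := by
  have hinj : Function.Injective fun i : Fin n => (i : ℤ) + 1 - k := fun i j h => by
    simp only at h
    exact Fin.ext (by omega)
  rw [← tsum_abs_intExtend]
  refine (Finset.abs_sum_le_sum_abs _ _).trans ?_
  rw [← tsum_fintype (L := .unconditional _)]
  exact Summable.tsum_le_tsum_of_inj _ hinj (fun _ _ => abs_nonneg _) (fun _ => le_rfl)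
    (Summable.of_finite) (summable_abs_intExtend hc)

theorem tsum_sq_sumWeight_le (hc : Summable fun k => |c k|) (n : ℕ) :
    ∑' k, sumWeight c n k ^ 2 ≤ n * (∑' k, |c k|) ^ 2 := by
  have h0 : 0 ≤ ∑' k, |c k| := tsum_nonneg fun _ => abs_nonneg _
  calc ∑' k, sumWeight c n k ^ 2 ≤ ∑' k, (∑' k, |c k|) * |sumWeight c n k| := by
        refine (summable_sq_of_summable_abs (summable_abs_sumWeight hc n)).tsum_le_tsum
          (fun k => ?_) ((summable_abs_sumWeight hc n).mul_left _)
        rw [← sq_abs, sq]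
        exact mul_le_mul_of_nonneg_right (abs_sumWeight_le hc n k) (abs_nonneg _)
    _ ≤ (∑' k, |c k|) * (n * ∑' k, |c k|) := by
        rw [tsum_mul_left]
        exact mul_le_mul_of_nonneg_left (tsum_abs_sumWeight_le hc n) h0
    _ = _ := by ring

/-- The weights are a convolution of the coefficients with the indicator of `1, …, n`, so their
Fourier series is a product. -/
theorem fourierSeries_sumWeight (hc : Summable fun k => |c k|) (n : ℕ) (l : ℝ) :
    fourierSeries (sumWeight c n) l =
      dirichletSum n l * ∑' k, (c k : ℂ) * Complex.exp (Complex.I * l) ^ k := by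
  have hs : ∀ i : Fin n, Summable fun k => intExtend c ((i : ℤ) + 1 - k) • expI (-k) l := fun i => by
    refine Summable.of_norm ?_
    simp_rw [norm_smul, norm_expI, mul_one]
    exact summable_abs_intExtend_sub hc _
  have hk : ∀ k, (sumWeight c n k : ℂ) * expI (-k) l =
      ∑ i : Fin n, intExtend c ((i : ℤ) + 1 - k) • expI (-k) l := fun k => by
    rw [sumWeight, Complex.ofReal_sum, Finset.sum_mul]
    rfl
  rw [fourierSeries]
  simp_rw [hk]
  rw [Summable.tsum_finsetSum fun i _ => hs i, dirichletSum, Finset.sum_mul]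
  refine Finset.sum_congr rfl fun i _ => ?_
  rw [tsum_intExtend_sub_smul c (fun k => expI (-k) l), ← tsum_mul_left]
  refine tsum_congr fun j => ?_
  rw [neg_sub, sub_eq_neg_add, expI_add, Complex.real_smul]
  have : expI (j : ℤ) l = Complex.exp (Complex.I * l) ^ j := by
    rw [expI, ← Complex.exp_nat_mul]; congr 1; push_cast; ring
  rw [this]
  ring

/-- If `g` is uniformly close to the spectral density of `γ`, then the variance of the sum of `n`
terms of the linear process built from `g` is close to the variance of the sum for `γ`. -/
theorem abs_innovVar_mul_sub_le {g : ℝ → ℝ} (hcand : IsSpectralCandidate g) (hlog : LogIntegrable g)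
    (hs : Summable fun k => |woldCoeff g k|) {γ : ℤ → ℝ} (hγ : Summable fun k => |γ k|) {δ : ℝ}
    (hδ : ∀ l ∈ Set.Icc (-Real.pi) Real.pi,
      |g l - (2 * Real.pi)⁻¹ * (fourierSeries γ l).re| ≤ δ) (n : ℕ) :
    |innovVar g * ∑' k, sumWeight (woldCoeff g) n k ^ 2 -
      ∑ i : Fin n, ∑ j : Fin n, γ ((j : ℤ) - i)| ≤ 2 * Real.pi * n * δ := by
  have hW := summable_abs_sumWeight hs n
  set a : ℝ → ℝ := fun l => innovVar g / (2 * Real.pi) *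
    ‖fourierSeries (sumWeight (woldCoeff g) n) l‖ ^ 2
  set b : ℝ → ℝ := fun l => (2 * Real.pi)⁻¹ * ((fourierSeries γ l).re * ‖dirichletSum n l‖ ^ 2)
  have hπ := Real.pi_pos
  have ha : ∫ l, a l ∂circleVolume = innovVar g * ∑' k, sumWeight (woldCoeff g) n k ^ 2 := by
    rw [integral_const_mul, integral_norm_sq_fourierSeries hW]
    field_simp
  have hb : ∫ l, b l ∂circleVolume = ∑ i : Fin n, ∑ j : Fin n, γ ((j : ℤ) - i) := by
    rw [integral_const_mul, integral_re_fourierSeries_mul hγ]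
    field_simp
  have hD : ∀ l, ‖dirichletSum n l‖ ≤ n := fun l => by
    refine (norm_sum_le _ _).trans ?_
    simp [norm_expI]
  have hDc := continuous_dirichletSum n
  have hac : Integrable a circleVolume := by
    refine Integrable.const_mul (Integrable.of_bound
      ((continuous_fourierSeries hW).norm.pow 2).aestronglyMeasurable
      ((∑' k, |sumWeight (woldCoeff g) n k|) ^ 2) (ae_of_all _ fun l => ?_)) _
    rw [Pi.pow_apply, norm_pow, norm_norm]
    exact pow_le_pow_left₀ (norm_nonneg _) (norm_fourierSeries_le hW l) 2
  have hDi : Integrable (fun l => ‖dirichletSum n l‖ ^ 2) circleVolume := by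
    refine Integrable.of_bound (hDc.norm.pow 2).aestronglyMeasurable ((n : ℝ) ^ 2)
      (ae_of_all _ fun l => ?_)
    rw [norm_pow, norm_norm]
    exact pow_le_pow_left₀ (norm_nonneg _) (hD l) 2
  have hbc : Integrable b circleVolume := by
    refine Integrable.const_mul (hDi.bdd_mul
      (Complex.continuous_re.comp (continuous_fourierSeries hγ)).aestronglyMeasurable
      (c := ∑' k, |γ k|) (ae_of_all _ fun l => ?_)) _
    exact (Complex.abs_re_le_norm _).trans (norm_fourierSeries_le hγ l)
  rw [← ha, ← hb, ← integral_sub hac hbc, ← Real.norm_eq_abs]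
  -- Once `g` is factorized, the difference of integrands is `(g - f)|D_n|²` almost everywhere; the
  -- total mass `2πn` of `|D_n|²` does the rest.
  calc _ ≤ ∫ l, δ * ‖dirichletSum n l‖ ^ 2 ∂circleVolume := by
        refine norm_integral_le_of_norm_le (hDi.const_mul δ) ?_
        have hae := ae_eq_innovVar_mul_norm_sq hcand hlog hs
        filter_upwards [(hae : ∀ᵐ x ∂circleVolume, _),
          (ae_restrict_mem measurableSet_Ioc : ∀ᵐ x ∂circleVolume, _)] with l hl hmem
        have : a l - b l =
            (g l - (2 * Real.pi)⁻¹ * (fourierSeries γ l).re) * ‖dirichletSum n l‖ ^ 2 := by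
          simp only [a, b]
          rw [fourierSeries_sumWeight hs, norm_mul, hl]
          ring
        rw [this, norm_mul, Real.norm_eq_abs, norm_pow, norm_norm]
        exact mul_le_mul_of_nonneg_right (hδ l (Set.Ioc_subset_Icc_self hmem)) (by positivity)
    _ = _ := by
        rw [integral_const_mul, integral_norm_sq_dirichletSum]; ring

theorem spectralDensity_eq (γ : ℤ → ℝ) (l : ℝ) :
    spectralDensity γ l = (2 * Real.pi)⁻¹ * (fourierSeries γ l).re := by
  have h : ∑' h : ℤ, (γ h : ℂ) * Complex.exp (-(Complex.I * h * l)) = fourierSeries γ l := by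
    refine tsum_congr fun k => ?_
    rw [expI]
    congr 2
    push_cast; ring
  rw [spectralDensity, h, ← Complex.re_ofReal_mul]
  push_cast
  rfl

theorem spectralDensity_neg (γ : ℤ → ℝ) (l : ℝ) :
    spectralDensity γ (-l) = spectralDensity γ l := by
  have h : fourierSeries γ (-l) = (starRingEnd ℂ) (fourierSeries γ l) := by
    rw [fourierSeries, fourierSeries, Complex.conj_tsum]
    refine tsum_congr fun k => ?_
    rw [map_mul, Complex.conj_ofReal, conj_expI, expI, expI]
    congr 2
    push_cast; ring
  rw [spectralDensity_eq, spectralDensity_eq, h, Complex.conj_re]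

theorem two_pi_mul_spectralDensity_zero (γ : ℤ → ℝ) :
    2 * Real.pi * spectralDensity γ 0 = ∑' h, γ h := by
  have : fourierSeries γ 0 = ((∑' h, γ h : ℝ) : ℂ) := by
    rw [fourierSeries, Complex.ofReal_tsum]
    simp [expI]
  have hπ := Real.pi_pos
  rw [spectralDensity_eq, this, Complex.ofReal_re]
  field_simp

end LinearWeights

/-! ### Nearly Gaussian laws, and uniformity of the limit theorem. -/

section NearGaussian

/-- A law with second moment within `δ` of `V` whose characteristic function is close to that of
the centred Gaussian law with the same second moment. -/
structure IsNearGaussian (V A b δ : ℝ) (ρ : Measure ℝ) : Prop where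
  isProbabilityMeasure : IsProbabilityMeasure ρ
  integrable_sq : Integrable (fun x => x ^ 2) ρ
  abs_moment_sub_le : |∫ x, x ^ 2 ∂ρ - V| ≤ δ
  norm_charFun_sub_le : ∀ t, ‖charFun ρ t - Complex.exp (-((∫ x, x ^ 2 ∂ρ) * t ^ 2 / 2 : ℝ))‖ ≤
    A * (4 * b * |t| ^ 3 + b ^ 2 * t ^ 4)

theorem integrable_sq_gaussianReal (v : ℝ≥0) :
    Integrable (fun x => x ^ 2) (gaussianReal 0 v) :=
  (memLp_id_gaussianReal 2).integrable_sq

theorem integral_sq_gaussianReal (v : ℝ≥0) : ∫ x, x ^ 2 ∂(gaussianReal 0 v) = v := by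
  have h := variance_id_gaussianReal (μ := 0) (v := v)
  rwa [variance_of_integral_eq_zero aemeasurable_id (by simp)] at h

theorem IsNearGaussian.tendsto_integral_sq {V b δ : ℕ → ℝ} {A v : ℝ} {ρ : ℕ → Measure ℝ}
    (hV : Tendsto V atTop (𝓝 v)) (hδ : Tendsto δ atTop (𝓝 0))
    (h : ∀ k, IsNearGaussian (V k) A (b k) (δ k) (ρ k)) :
    Tendsto (fun k => ∫ x, x ^ 2 ∂(ρ k)) atTop (𝓝 v) := by
  have h0 : Tendsto (fun k => ∫ x, x ^ 2 ∂(ρ k) - V k) atTop (𝓝 0) :=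
    squeeze_zero_norm (fun k => (h k).abs_moment_sub_le) hδ
  have h1 := h0.add hV
  simp only [sub_add_cancel, zero_add] at h1
  exact h1

theorem IsNearGaussian.tendsto_charFun {V b δ : ℕ → ℝ} {A : ℝ} {v : ℝ≥0} {ρ : ℕ → Measure ℝ}
    (hm : Tendsto (fun k => ∫ x, x ^ 2 ∂(ρ k)) atTop (𝓝 v)) (hb : Tendsto b atTop (𝓝 0))
    (h : ∀ k, IsNearGaussian (V k) A (b k) (δ k) (ρ k)) (t : ℝ) :
    Tendsto (fun k => charFun (ρ k) t) atTop (𝓝 (charFun (gaussianReal 0 v) t)) := by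
  have hg : charFun (gaussianReal 0 v) t = Complex.exp (-((v : ℝ) * t ^ 2 / 2 : ℝ)) := by
    rw [charFun_gaussianReal]
    congr 1
    push_cast; ring
  have hc : Continuous fun x : ℝ => Complex.exp (-(x * t ^ 2 / 2 : ℝ)) := by fun_prop
  have h1 := (hc.tendsto v).comp hm
  have h2 : Tendsto (fun k => charFun (ρ k) t -
      Complex.exp (-((∫ x, x ^ 2 ∂(ρ k)) * t ^ 2 / 2 : ℝ))) atTop (𝓝 0) := by
    refine squeeze_zero_norm (fun k => (h k).norm_charFun_sub_le t) ?_
    have := (((hb.const_mul 4).mul_const (|t| ^ 3)).add ((hb.pow 2).mul_const (t ^ 4))).const_mul A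
    rwa [mul_zero, zero_mul, zero_pow two_ne_zero, zero_mul, add_zero, mul_zero] at this
  have h3 := h2.add h1
  rw [zero_add, ← hg] at h3
  refine h3.congr fun k => ?_
  exact sub_add_cancel _ _

/-- Nearly Gaussian laws are close to a Gaussian law in Mallows' distance. -/
theorem tendsto_mallows_of_isNearGaussian {V b δ : ℕ → ℝ} {A : ℝ} {v : ℝ≥0}
    {ρ : ℕ → ProbabilityMeasure ℝ} {N : ProbabilityMeasure ℝ}
    (hN : (N : Measure ℝ) = gaussianReal 0 v)
    (hV : Tendsto V atTop (𝓝 v)) (hb : Tendsto b atTop (𝓝 0)) (hδ : Tendsto δ atTop (𝓝 0))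
    (h : ∀ k, IsNearGaussian (V k) A (b k) (δ k) (ρ k)) :
    Tendsto (fun k => mallows (ρ k : Measure ℝ) (gaussianReal 0 v)) atTop (𝓝 0) := by
  have hm := IsNearGaussian.tendsto_integral_sq hV hδ h
  have hw : Tendsto ρ atTop (𝓝 N) := by
    rw [ProbabilityMeasure.tendsto_iff_tendsto_charFun, hN]
    exact IsNearGaussian.tendsto_charFun hm hb h
  rw [← hN]
  refine tendsto_mallows_of_tendsto hw (fun k => (h k).integrable_sq) ?_ ?_
  · rw [hN]
    exact integrable_sq_gaussianReal v
  · rw [hN, integral_sq_gaussianReal]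
    exact hm

/-- Uniform version of `tendsto_mallows_of_isNearGaussian`. -/
theorem exists_forall_mallows_lt {V b : ℕ → ℝ} {A B : ℝ} {v : ℝ≥0}
    (hV : Tendsto V atTop (𝓝 v)) (hb : Tendsto b atTop (𝓝 0)) {η : ℝ≥0∞} (hη : 0 < η) :
    ∃ n₀ : ℕ, ∃ δ : ℝ, 0 < δ ∧ ∀ n ≥ n₀, ∀ ρ : Measure ℝ,
      IsNearGaussian (V n) A (b n) (B * δ) ρ → mallows ρ (gaussianReal 0 v) < η := by
  -- Otherwise the tolerances `1/(k+1)` produce a sequence of offending laws with indices tending to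
  -- infinity, against the sequential statement.
  by_contra! hcon
  choose n hn ρ hρ hlt using fun k : ℕ => hcon k (1 / ((k : ℝ) + 1)) (by positivity)
  have hn' : Tendsto n atTop atTop := tendsto_atTop_mono hn tendsto_id
  have hδ : Tendsto (fun k : ℕ => B * (1 / ((k : ℝ) + 1))) atTop (𝓝 0) := by
    have := (tendsto_one_div_add_atTop_nhds_zero_nat (𝕜 := ℝ)).const_mul B
    rwa [mul_zero] at this
  have := tendsto_mallows_of_isNearGaussian
    (ρ := fun k => ⟨ρ k, (hρ k).isProbabilityMeasure⟩) (N := ⟨gaussianReal 0 v, inferInstance⟩)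
    rfl (hV.comp hn') (hb.comp hn') hδ hρ
  obtain ⟨k, hk⟩ := (this.eventually_lt_const hη).exists
  exact absurd hk (not_lt.2 (hlt k))

end NearGaussian

/-! ### The conditional law of the bootstrap statistic. -/

section Bootstrap

variable {Ω' : Type*} [MeasurableSpace Ω'] {ε : ℤ → Ω' → ℝ} {Q : Measure Ω'}
  [IsProbabilityMeasure Q] {K : ℝ} {g : ℝ → ℝ}

/-- The terms are regrouped by innovation instead of by time. This needs convergence of the series,
hence holds only almost surely. -/
theorem sqrt_mul_mean_pseudoSeries_sub {v : ℝ} (hε : IsInnovation ε Q v K)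
    (hs : Summable fun k => |woldCoeff g k|) (m : ℝ) {n : ℕ} (hn : 1 ≤ n) :
    (fun ω' => √(n : ℝ) * (mean (pseudoSeries g m ε n ω') - m)) =ᵐ[Q]
      fun ω' => ∑' k, sumWeight (woldCoeff g) n k / √(n : ℝ) * ε k ω' := by
  have hn0 : (0 : ℝ) < n := by exact_mod_cast hn
  have hae : ∀ᵐ ω' ∂Q, ∀ i : Fin n, Summable fun k =>
      |intExtend (woldCoeff g) ((i : ℤ) + 1 - k) * ε k ω'| :=
    ae_all_iff.2 fun i => hε.ae_summable_abs (summable_abs_intExtend_sub hs _)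
  filter_upwards [hae] with ω' hω
  have h1 : ∀ k, sumWeight (woldCoeff g) n k / √(n : ℝ) * ε k ω' =
      (√(n : ℝ))⁻¹ * ∑ i : Fin n, intExtend (woldCoeff g) ((i : ℤ) + 1 - k) * ε k ω' := fun k => by
    rw [sumWeight, ← Finset.sum_mul]; ring
  have h2 : ∀ i : Fin n, ∑' k, intExtend (woldCoeff g) ((i : ℤ) + 1 - k) * ε k ω' =
      ∑' j : ℕ, woldCoeff g j * ε ((i : ℤ) + 1 - j) ω' := fun i =>
    tsum_intExtend_sub_smul (woldCoeff g) (fun k => ε k ω') ((i : ℤ) + 1)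
  simp_rw [h1]
  rw [tsum_mul_left, Summable.tsum_finsetSum fun i _ => (hω i).of_abs]
  simp_rw [h2]
  simp only [mean, pseudoSeries, Finset.sum_add_distrib, Finset.sum_const, Finset.card_univ,
    Fintype.card_fin, nsmul_eq_mul]
  rw [add_div, mul_div_cancel_left₀ _ hn0.ne', add_sub_cancel_right]
  have hsq := Real.mul_self_sqrt hn0.le
  have hsp := Real.sqrt_pos.2 hn0
  field_simp
  rw [sq, hsq, mul_comm]

/-- The conditional law of the bootstrap statistic is nearly Gaussian, with variance close to that
of the normalized sum of the observed process. -/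
theorem isNearGaussian_map_pseudoSeries (hcand : IsSpectralCandidate g) (hlog : LogIntegrable g)
    (hs : Summable fun k => |woldCoeff g k|) {C : ℝ} (hC : ∑' k, |woldCoeff g k| ≤ C)
    (hε : IsInnovation ε Q (innovVar g) K) {γ : ℤ → ℝ} (hγ : Summable fun k => |γ k|) {δ : ℝ}
    (hδ : ∀ l ∈ Set.Icc (-Real.pi) Real.pi, |g l - spectralDensity γ l| ≤ δ) (m : ℝ) {n : ℕ}
    (hn : 1 ≤ n) :
    IsNearGaussian ((∑ i : Fin n, ∑ j : Fin n, γ ((j : ℤ) - i)) / n) ((1 + K) * C ^ 2)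
      (C / √(n : ℝ)) (2 * Real.pi * δ)
      (Q.map fun ω' => √(n : ℝ) * (mean (pseudoSeries g m ε n ω') - m)) := by
  have hn0 : (0 : ℝ) < n := by exact_mod_cast hn
  have hsp := Real.sqrt_pos.2 hn0
  have hC0 : 0 ≤ ∑' k, |woldCoeff g k| := tsum_nonneg fun _ => abs_nonneg _
  have hK := hε.fourth_bound_pos
  set w : ℤ → ℝ := fun k => sumWeight (woldCoeff g) n k / √(n : ℝ)
  have hw : Summable fun k => |w k| := by
    simp only [w, abs_div]
    exact (summable_abs_sumWeight hs n).div_const _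
  have hwsq : ∑' k, w k ^ 2 = (∑' k, sumWeight (woldCoeff g) n k ^ 2) / n := by
    simp only [w, div_pow, Real.sq_sqrt hn0.le, tsum_div_const]
  have hwb : ∀ k, |w k| ≤ C / √(n : ℝ) := fun k => by
    simp only [w, abs_div, abs_of_pos hsp]
    exact div_le_div_of_nonneg_right ((abs_sumWeight_le hs n k).trans hC) hsp.le
  have hwC : ∑' k, w k ^ 2 ≤ C ^ 2 := by
    rw [hwsq, div_le_iff₀ hn0, mul_comm]
    exact (tsum_sq_sumWeight_le hs n).trans
      (mul_le_mul_of_nonneg_left (pow_le_pow_left₀ hC0 hC 2) hn0.le)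
  rw [Measure.map_congr (sqrt_mul_mean_pseudoSeries_sub hε hs m hn)]
  have hm : AEMeasurable (fun ω' => ∑' k, w k * ε k ω') Q := hε.aemeasurable_tsum hw
  have hmom : ∫ x, x ^ 2 ∂(Q.map fun ω' => ∑' k, w k * ε k ω') =
      innovVar g * ∑' k, w k ^ 2 := by
    rw [integral_map hm (by fun_prop), hε.integral_tsum_sq hw]
  refine ⟨Measure.isProbabilityMeasure_map hm, ?_, ?_, fun t => ?_⟩
  · rw [integrable_map_measure (by fun_prop) hm]
    exact hε.integrable_tsum_sq hw
  · rw [hmom, hwsq, ← mul_div_assoc, ← sub_div, abs_div, abs_of_pos hn0, div_le_iff₀ hn0]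
    simp_rw [spectralDensity_eq] at hδ
    refine (abs_innovVar_mul_sub_le hcand hlog hs hγ hδ n).trans (le_of_eq ?_)
    ring
  · rw [hmom]
    refine (hε.norm_charFun_tsum_sub_le hw hwb t).trans ?_
    have hCn : 0 ≤ C / √(n : ℝ) := div_nonneg (hC0.trans hC) hsp.le
    calc _ ≤ (1 + K) * (4 * (C / √(n : ℝ)) * |t| ^ 3 + (C / √(n : ℝ)) ^ 2 * t ^ 4) * C ^ 2 :=
          mul_le_mul_of_nonneg_left hwC (by positivity)
      _ = _ := by ring

end Bootstrap

/-! ### The normalized sample mean of the observed process. -/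

section ObservedProcess

theorem sqrt_mul_mean_sample_sub {Ω : Type*} (X : ℤ → Ω → ℝ) (μ : ℝ) {n : ℕ} (hn : 1 ≤ n) (ω : Ω) :
    √(n : ℝ) * (mean (sample X n ω) - μ) = (√(n : ℝ))⁻¹ * ∑ i : Fin n, (X ((i : ℤ) + 1) ω - μ) := by
  have hn0 : (0 : ℝ) < n := by exact_mod_cast hn
  have hsq := Real.mul_self_sqrt hn0.le
  have hsp := Real.sqrt_pos.2 hn0
  rw [Finset.sum_sub_distrib]
  simp only [mean, sample, Finset.sum_const, Finset.card_univ, Fintype.card_fin, nsmul_eq_mul]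
  field_simp
  rw [sq, hsq]

variable {Ω : Type*} [MeasurableSpace Ω] {P : Measure Ω} {X : ℤ → Ω → ℝ}

theorem IsStationary.covariance_eq (hX : IsStationary X P) (s t : ℤ) :
    cov[X s, X t; P] = autocov X P (t - s) := by
  have := hX.cov_eq s (t - s)
  rwa [add_sub_cancel] at this

variable [IsProbabilityMeasure P]

theorem IsStationary.memLp_sqrt_mul_mean_sub (hX : IsStationary X P) (μ : ℝ) {n : ℕ} (hn : 1 ≤ n) :
    MemLp (fun ω => √(n : ℝ) * (mean (sample X n ω) - μ)) 2 P := by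
  simp_rw [sqrt_mul_mean_sample_sub X μ hn]
  exact (memLp_finsetSum _ fun i _ => (hX.memLp _).sub (memLp_const μ)).const_mul _

theorem IsStationary.integral_sq_sqrt_mul_mean_sub (hX : IsStationary X P) {n : ℕ} (hn : 1 ≤ n) :
    ∫ ω, (√(n : ℝ) * (mean (sample X n ω) - ∫ ω, X 0 ω ∂P)) ^ 2 ∂P =
      (∑ i : Fin n, ∑ j : Fin n, autocov X P ((j : ℤ) - i)) / n := by
  have hn0 : (0 : ℝ) < n := by exact_mod_cast hn
  set μ := ∫ ω, X 0 ω ∂P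
  have hc : ∀ t, MemLp (fun ω => X t ω - μ) 2 P := fun t => (hX.memLp t).sub (memLp_const μ)
  have hi : ∀ s t, Integrable (fun ω => (X s ω - μ) * (X t ω - μ)) P := fun s t =>
    (hc s).integrable_mul (hc t)
  have hcov : ∀ s t, ∫ ω, (X s ω - μ) * (X t ω - μ) ∂P = autocov X P (t - s) := fun s t => by
    rw [← hX.covariance_eq, covariance, hX.mean_eq s, hX.mean_eq t]
  have he : ∀ ω, (√(n : ℝ) * (mean (sample X n ω) - μ)) ^ 2 =
      (∑ i : Fin n, ∑ j : Fin n, (X ((i : ℤ) + 1) ω - μ) * (X ((j : ℤ) + 1) ω - μ)) / n :=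
    fun ω => by
      rw [sqrt_mul_mean_sample_sub X μ hn, mul_pow, inv_pow, Real.sq_sqrt hn0.le, sq,
        Finset.sum_mul_sum, inv_mul_eq_div]
  simp_rw [he]
  rw [integral_div, integral_finsetSum _ fun i _ => integrable_finsetSum _ fun j _ => hi _ _]
  congr 1
  refine Finset.sum_congr rfl fun i _ => ?_
  rw [integral_finsetSum _ fun j _ => hi _ _]
  refine Finset.sum_congr rfl fun j _ => ?_
  rw [hcov]
  congr 1
  ring

end ObservedProcess

/-- The normalized sample mean of the observed process converges to its Gaussian limit in Mallows'
distance. -/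
theorem IsStationary.tendsto_mallows_gaussianReal
    {Ω : Type*} [MeasurableSpace Ω] {P : Measure Ω} [IsProbabilityMeasure P] {X : ℤ → Ω → ℝ}
    (hX : IsStationary X P) {μ : ℝ} (hμ : ∫ ω, X 0 ω ∂P = μ) {v : ℝ≥0}
    (hV : Tendsto (fun n : ℕ => (∑ i : Fin n, ∑ j : Fin n, autocov X P ((j : ℤ) - i)) / n) atTop
      (𝓝 v))
    (hclt : TendstoInDistribution
      (fun (n : ℕ) ω => √(n : ℝ) * (mean (sample X n ω) - μ)) atTop
      (id : ℝ → ℝ) (fun _ => P) (gaussianReal 0 v)) :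
    Tendsto (fun n : ℕ => mallows (P.map fun ω => √(n : ℝ) * (mean (sample X n ω) - μ))
      (gaussianReal 0 v)) atTop (𝓝 0) := by
  have hN : (gaussianReal 0 v).map id = gaussianReal 0 v := Measure.map_id
  have hmom : ∀ n : ℕ, 1 ≤ n → ∫ x, x ^ 2 ∂(P.map fun ω => √(n : ℝ) * (mean (sample X n ω) - μ)) =
      (∑ i : Fin n, ∑ j : Fin n, autocov X P ((j : ℤ) - i)) / n := fun n hn => by
    rw [integral_map (hclt.forall_aemeasurable n) (by fun_prop), ← hμ,
      hX.integral_sq_sqrt_mul_mean_sub hn]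
  -- Indices are shifted by one because the moment identities are stated for `n ≥ 1`.
  have key := tendsto_mallows_of_tendsto (hclt.tendsto.comp (tendsto_add_atTop_nat 1))
    (fun n => ?_) ?_ ?_
  · refine (tendsto_add_atTop_iff_nat 1).1 (key.congr fun n => ?_)
    simp only [ProbabilityMeasure.coe_mk, hN]
    rfl
  · change Integrable (fun x => x ^ 2)
      (P.map fun ω => √((n + 1 : ℕ) : ℝ) * (mean (sample X (n + 1) ω) - μ))
    rw [integrable_map_measure (by fun_prop) (hclt.forall_aemeasurable _)]
    exact (hX.memLp_sqrt_mul_mean_sub μ (Nat.le_add_left 1 n)).integrable_sq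
  · simp only [ProbabilityMeasure.coe_mk, hN]
    exact integrable_sq_gaussianReal v
  · simp only [ProbabilityMeasure.coe_mk, hN, integral_sq_gaussianReal]
    refine ((tendsto_add_atTop_iff_nat 1).2 hV).congr fun n => ?_
    exact (hmom (n + 1) (Nat.le_add_left 1 n)).symm

end SDDB

end

/-! ### Bootstrap consistency for the sample mean. -/

theorem mainTheorem2
    {Ω : Type*} [MeasurableSpace Ω] (P : Measure Ω) [IsProbabilityMeasure P]
    -- the observed process
    (X : ℤ → Ω → ℝ) (hX : SDDB.IsStationary X P) (hpnd : SDDB.IsPurelyNondeterministic X P)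
    (μ : ℝ) (hμ : ∫ ω, X 0 ω ∂P = μ)
    (hγ : Summable fun h : ℤ => |SDDB.autocov X P h|)
    (f : ℝ → ℝ) (hf : f = SDDB.spectralDensity (SDDB.autocov X P))
    (hclt : TendstoInDistribution
      (fun (n : ℕ) ω => √(n : ℝ) * (SDDB.mean (SDDB.sample X n ω) - μ)) atTop
      (id : ℝ → ℝ) (fun _ => P) (gaussianReal 0 (2 * Real.pi * f 0).toNNReal))
    -- the spectral density estimator, a function of the observations
    (fhat : (n : ℕ) → (Fin n → ℝ) → ℝ → ℝ)
    (hcand : ∀ n, 1 ≤ n → ∀ᵐ ω ∂P, SDDB.IsSpectralCandidate (fhat n (SDDB.sample X n ω)))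
    (hbdd : ∀ n, 1 ≤ n → ∀ᵐ ω ∂P, ∃ B : ℝ, ∀ l ∈ Set.Icc (-Real.pi) Real.pi,
      fhat n (SDDB.sample X n ω) l ≤ B)
    (hlog : ∀ n, 1 ≤ n → ∀ᵐ ω ∂P, SDDB.LogIntegrable (fhat n (SDDB.sample X n ω)))
    (hunif : SDDB.TendstoZeroInProb P
      (fun (n : ℕ) ω => ⨆ l ∈ Set.Icc (0 : ℝ) Real.pi,
        ENNReal.ofReal |fhat n (SDDB.sample X n ω) l - f l|))
    (C : ℝ)
    (hc : ∀ n, 1 ≤ n → ∀ᵐ ω ∂P,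
      Summable (fun k => |SDDB.woldCoeff (fhat n (SDDB.sample X n ω)) k|) ∧
        ∑' k, |SDDB.woldCoeff (fhat n (SDDB.sample X n ω)) k| < C)
    -- the bootstrap world: given the observations `x`, the pseudo innovations `ε n x t` live on
    -- `Ω'` under the conditional probability measure `Q n x`
    {Ω' : Type*} [MeasurableSpace Ω'] (Q : (n : ℕ) → (Fin n → ℝ) → Measure Ω')
    [∀ n x, IsProbabilityMeasure (Q n x)]
    (ε : (n : ℕ) → (Fin n → ℝ) → ℤ → Ω' → ℝ) (K : ℝ)
    (hε : ∀ n, 1 ≤ n → ∀ᵐ ω ∂P,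
      SDDB.IsInnovation (ε n (SDDB.sample X n ω)) (Q n (SDDB.sample X n ω))
        (SDDB.innovVar (fhat n (SDDB.sample X n ω))) K) :
    SDDB.TendstoZeroInProb P
      (fun (n : ℕ) ω =>
        let x := SDDB.sample X n ω
        SDDB.mallows
          ((Q n x).map fun ω' => √(n : ℝ) *
            (SDDB.mean (SDDB.pseudoSeries (fhat n x) (SDDB.mean x) (ε n x) n ω') - SDDB.mean x))
          (P.map fun ω => √(n : ℝ) * (SDDB.mean (SDDB.sample X n ω) - μ))) := by
  set γ := SDDB.autocov X P with hγdef
  have hγs : Summable γ := hγ.of_abs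
  let V : ℕ → ℝ := fun n => (∑ i : Fin n, ∑ j : Fin n, γ ((j : ℤ) - i)) / n
  have hV0 : Tendsto V atTop (𝓝 (∑' h, γ h)) := SDDB.tendsto_sum_sum_div hγs
  have hf0 : 2 * Real.pi * f 0 = ∑' h, γ h := by
    rw [hf, SDDB.two_pi_mul_spectralDensity_zero]
  -- As a limit of variances the sum is nonnegative, so `toNNReal` in the limiting variance
  -- truncates nothing.
  have hnn : 0 ≤ ∑' h, γ h := by
    refine ge_of_tendsto hV0 ?_
    filter_upwards [eventually_ge_atTop 1] with n hn
    rw [show V n = _ from (hX.integral_sq_sqrt_mul_mean_sub hn).symm]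
    exact integral_nonneg fun _ => sq_nonneg _
  set v : ℝ≥0 := (2 * Real.pi * f 0).toNNReal with hv
  have hV : Tendsto V atTop (𝓝 v) := by
    rwa [hv, hf0, Real.coe_toNNReal _ hnn]
  have hobs := hX.tendsto_mallows_gaussianReal hμ hV hclt
  have hb : Tendsto (fun n : ℕ => C / √(n : ℝ)) atTop (𝓝 0) :=
    (Real.tendsto_sqrt_atTop.comp tendsto_natCast_atTop_atTop).const_div_atTop C
  intro δ hδ
  -- Half of the threshold for each of the two laws; the cap at `1` keeps it finite when `δ` is
  -- infinite.
  have hη : 0 < min δ 1 / 2 :=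
    ENNReal.half_pos (lt_min hδ one_pos).ne'
  obtain ⟨n₀, δ', hδ', hclose⟩ := SDDB.exists_forall_mallows_lt (A := (1 + K) * C ^ 2)
    (B := 2 * Real.pi) hV hb hη
  have hsup := hunif (ENNReal.ofReal δ') (ENNReal.ofReal_pos.2 hδ')
  -- For large `n` the event of a large distance is contained, up to a null set, in the event that
  -- the uniform error is at least `δ'`. Monotonicity of outer measure suffices, so no measurability
  -- of the distance is involved.
  refine tendsto_of_tendsto_of_tendsto_of_le_of_le' tendsto_const_nhds hsup
    (Eventually.of_forall fun _ => zero_le) ?_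
  filter_upwards [eventually_ge_atTop 1, eventually_ge_atTop n₀,
    hobs.eventually_lt_const hη] with n hn hn₀ hobsn
  refine measure_mono_ae ?_
  filter_upwards [hcand n hn, hlog n hn, hc n hn, hε n hn] with ω h1 h2 h3 h4 hω
  by_contra hlt
  have hlt : (⨆ l ∈ Set.Icc (0 : ℝ) Real.pi,
    ENNReal.ofReal |fhat n (SDDB.sample X n ω) l - f l|) < ENNReal.ofReal δ' := not_le.1 hlt
  have hhalf : ∀ l ∈ Set.Icc (0 : ℝ) Real.pi,
      |fhat n (SDDB.sample X n ω) l - SDDB.spectralDensity γ l| ≤ δ' := fun l hl => by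
    rw [← hf]
    exact (ENNReal.ofReal_le_ofReal_iff hδ'.le).1 ((le_iSup₂ (f := fun l _ =>
      ENNReal.ofReal |fhat n (SDDB.sample X n ω) l - f l|) l hl).trans hlt.le)
  -- Closeness is known on `[0, π]` only; evenness of both functions carries it to `[-π, π]`.
  have hfull : ∀ l ∈ Set.Icc (-Real.pi) Real.pi,
      |fhat n (SDDB.sample X n ω) l - SDDB.spectralDensity γ l| ≤ δ' := fun l hl => by
    rcases le_total 0 l with h0 | h0
    · exact hhalf l ⟨h0, hl.2⟩
    · rw [← (h1 l hl).2, ← SDDB.spectralDensity_neg]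
      exact hhalf (-l) ⟨by linarith, by linarith [hl.1]⟩
  have hnear := SDDB.isNearGaussian_map_pseudoSeries h1 h2 h3.1 h3.2.le h4 hγ hfull
    (SDDB.mean (SDDB.sample X n ω)) hn
  have hboot := hclose n hn₀ _ hnear
  have hprob := hnear.isProbabilityMeasure
  have hsum := (SDDB.mallows_triangle _ _ (gaussianReal 0 v)).trans_lt
    (ENNReal.add_lt_add hboot ((SDDB.mallows_comm _ _).trans_lt hobsn))
  rw [ENNReal.add_halves] at hsum
  exact absurd (hω.trans_lt hsum) (not_lt.2 (min_le_left _ _))
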